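/- Let $A$ be a C*-algebra, let $\mathcal K$ be the C*-algebra of compact operators on $\ell^2(\mathbb N)$, and let $(A\otimes\mathcal K)^\sim$ be the unitization of $A\otimes\mathcal K$. Positive elements $a,b$ of a C*-algebra $B$ are called stably approximately unitarily equivalent if there are unitaries $u_n\in(B\otimes\mathcal K)^\sim$, $n=1,2,\dots$, with $u_n^*au_n\to b$, where $B$ is identified with the top left corner of $B\otimes\mathcal K$. The C*-algebra $B$ has property (I) if for all $x,e\in B$ such that $e$ is a positive contraction and $ex=xe=x$, the element $x^*x+e$ is stably approximately unitarily equivalent to $xx^*+e$. The Cuntz semigroup $\mathrm{Cu}(A)$ is the set of classes $[a]$ of positive elements $a\in A\otimes\mathcal K$ for the equivalence relation associated with Cuntz comparison ($a\preccurlyeq b$ if $d_n^*bd_n\to a$ for some $d_n\in A\otimes\mathcal K$), ordered by $[a]\le[b]$ if $a\preccurlyeq b$, with $[a]+[b]=[a'+b']$ for mutually orthogonal positive $a',b'\in A\otimes\mathcal K$ that are Murray–von Neumann equivalent to $a$ and $b$. For $x,y\in\mathrm{Cu}(A)$ write $x\ll y$ if for every increasing sequence $(y_n)$ in $\mathrm{Cu}(A)$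 that has a supremum with $y\le\sup_n y_n$ there is $k$ with $x\le y_k$. Proposition. If $(A\otimes\mathcal K)^\sim$ has property (I), then $\mathrm{Cu}(A)$ has weak cancellation: for all $x,y,z\in\mathrm{Cu}(A)$, if $x+z\ll y+z$, then $x\le y$. -/

import Mathlib

open Filter Topology

noncomputable section

/-! ### Completion of a pre-C⋆-algebra -/

/-- The norm completion of a normed algebra `P`. -/
def CStarCompletion (P : Type*) [NonUnitalNormedRing P] : Type _ := UniformSpace.Completion P

namespace CStarCompletion

section Normed

variable (P : Type*) [NonUnitalNormedRing P] [NormedSpace ℂ P]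

instance : NormedAddCommGroup (CStarCompletion P) :=
  inferInstanceAs (NormedAddCommGroup (UniformSpace.Completion P))

instance : NormedSpace ℂ (CStarCompletion P) :=
  inferInstanceAs (NormedSpace ℂ (UniformSpace.Completion P))

instance : CompleteSpace (CStarCompletion P) :=
  inferInstanceAs (CompleteSpace (UniformSpace.Completion P))

/-- The canonical isometric embedding of `P` into its completion. -/
def of : P →ₗᵢ[ℂ] CStarCompletion P := UniformSpace.Completion.toComplₗᵢ

variable {P}

theorem isDenseInducing_of : IsDenseInducing (of P) :=
  UniformSpace.Completion.isDenseInducing_coe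

@[elab_as_elim]
theorem induction_on {p : CStarCompletion P → Prop} (x : CStarCompletion P)
    (hc : IsClosed {x | p x}) (h : ∀ a, p (of P a)) : p x :=
  isClosed_property isDenseInducing_of.dense hc h x

@[elab_as_elim]
theorem induction_on₂ {p : CStarCompletion P → CStarCompletion P → Prop} (x y : CStarCompletion P)
    (hc : IsClosed {q : CStarCompletion P × CStarCompletion P | p q.1 q.2})
    (h : ∀ a b, p (of P a) (of P b)) : p x y :=
  isClosed_property2 isDenseInducing_of.dense hc h x y

@[elab_as_elim]
theorem induction_on₃ {p : CStarCompletion P → CStarCompletion P → CStarCompletion P → Prop}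
    (x y z : CStarCompletion P)
    (hc : IsClosed {q : CStarCompletion P × CStarCompletion P × CStarCompletion P |
      p q.1 q.2.1 q.2.2})
    (h : ∀ a b c, p (of P a) (of P b) (of P c)) : p x y z :=
  isClosed_property3 isDenseInducing_of.dense hc h x y z

/-- The multiplication extended by continuity. -/
instance : Mul (CStarCompletion P) where
  mul x y := (isDenseInducing_of.prodMap isDenseInducing_of).extend
    (fun q : P × P => of P (q.1 * q.2)) (x, y)

theorem of_mul (a b : P) : of P (a * b) = of P a * of P b :=
  ((isDenseInducing_of.prodMap isDenseInducing_of).extend_eq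
    (f := fun q : P × P => of P (q.1 * q.2))
    ((of P).continuous.comp continuous_mul) (a, b)).symm

instance : ContinuousMul (CStarCompletion P) where
  continuous_mul := by
    let m : P →+ P →+ CStarCompletion P :=
      (AddMonoidHom.mul : P →+ P →+ P).compr₂ (of P).toLinearMap.toAddMonoidHom
    have hm : Continuous fun p : P × P => m p.1 p.2 := (of P).continuous.comp continuous_mul
    have di : IsDenseInducing ((of P).toLinearMap.toAddMonoidHom : P → CStarCompletion P) :=
      isDenseInducing_of
    exact di.extend_Z_bilin di hm

instance : NonUnitalRing (CStarCompletion P) where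
  __ := (inferInstance : NormedAddCommGroup (CStarCompletion P))
  zero_mul x := induction_on x (isClosed_eq (by fun_prop) continuous_const)
    fun a => by rw [← map_zero (of P), ← of_mul, zero_mul]
  mul_zero x := induction_on x (isClosed_eq (by fun_prop) continuous_const)
    fun a => by rw [← map_zero (of P), ← of_mul, mul_zero]
  mul_assoc x y z := induction_on₃ x y z (isClosed_eq (by fun_prop) (by fun_prop))
    fun a b c => by simp only [← of_mul, mul_assoc]
  left_distrib x y z := induction_on₃ x y z (isClosed_eq (by fun_prop) (by fun_prop))
    fun a b c => by simp only [← of_mul, ← map_add, mul_add]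
  right_distrib x y z := induction_on₃ x y z (isClosed_eq (by fun_prop) (by fun_prop))
    fun a b c => by simp only [← of_mul, ← map_add, add_mul]

instance : NonUnitalNormedRing (CStarCompletion P) where
  __ := (inferInstance : NormedAddCommGroup (CStarCompletion P))
  __ := (inferInstance : NonUnitalRing (CStarCompletion P))
  norm_mul_le x y := induction_on₂ x y (isClosed_le (by fun_prop) (by fun_prop))
    fun a b => by simpa only [← of_mul, LinearIsometry.norm_map] using norm_mul_le a b

/-- The continuous extension to the completion of an isometry of `P`. -/
def extend (f : P → P) : CStarCompletion P → CStarCompletion P := UniformSpace.Completion.map f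

theorem extend_of {f : P → P} (hf : Isometry f) (a : P) : extend f (of P a) = of P (f a) :=
  UniformSpace.Completion.map_coe hf.uniformContinuous a

theorem continuous_extend (f : P → P) : Continuous (extend f) :=
  UniformSpace.Completion.continuous_map

theorem continuous_smul_comp {X : Type*} [TopologicalSpace X] (r : ℂ) {f : X → CStarCompletion P}
    (hf : Continuous f) : Continuous fun x => r • f x :=
  (continuous_const_smul r).comp hf

instance [IsScalarTower ℂ P P] : IsScalarTower ℂ (CStarCompletion P) (CStarCompletion P) where
  smul_assoc r x y := by
    rw [smul_eq_mul, smul_eq_mul]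
    induction x, y using induction_on₂ with
    | hc =>
      exact isClosed_eq ((continuous_smul_comp r continuous_fst).mul continuous_snd)
        (continuous_smul_comp r (continuous_fst.mul continuous_snd))
    | h a b => simp only [← of_mul, ← map_smul, smul_mul_assoc]

instance [SMulCommClass ℂ P P] : SMulCommClass ℂ (CStarCompletion P) (CStarCompletion P) where
  smul_comm r x y := by
    rw [smul_eq_mul, smul_eq_mul]
    induction x, y using induction_on₂ with
    | hc =>
      exact isClosed_eq (continuous_smul_comp r (continuous_fst.mul continuous_snd))
        (continuous_fst.mul (continuous_smul_comp r continuous_snd))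
    | h a b => simp only [← of_mul, ← map_smul, mul_smul_comm]

end Normed

section Star

variable {P : Type*} [NonUnitalNormedRing P] [StarRing P] [CStarRing P] [NormedSpace ℂ P]

/-- The involution extended by continuity. -/
instance : Star (CStarCompletion P) := ⟨extend star⟩

theorem of_star (a : P) : of P (star a) = star (of P a) := (extend_of star_isometry a).symm

instance : ContinuousStar (CStarCompletion P) := ⟨continuous_extend star⟩

instance : StarRing (CStarCompletion P) where
  star_involutive x := induction_on x (isClosed_eq (by fun_prop) (by fun_prop))
    fun a => by simp only [← of_star, star_star]
  star_mul x y := induction_on₂ x y (isClosed_eq (by fun_prop) (by fun_prop))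
    fun a b => by simp only [← of_star, ← of_mul, star_mul]
  star_add x y := induction_on₂ x y (isClosed_eq (by fun_prop) (by fun_prop))
    fun a b => by simp only [← of_star, ← map_add, star_add]

instance : CStarRing (CStarCompletion P) where
  norm_mul_self_le x := induction_on x (isClosed_le (by fun_prop) (by fun_prop))
    fun a => by
      simpa only [← of_star, ← of_mul, LinearIsometry.norm_map] using
        (CStarRing.norm_star_mul_self (x := a)).ge

instance [StarModule ℂ P] : StarModule ℂ (CStarCompletion P) where
  star_smul r x := induction_on x (isClosed_eq (continuous_star.comp (continuous_smul_comp r continuous_id))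
      (continuous_smul_comp (star r) continuous_star))
    fun a => by simp only [← of_star, ← map_smul, star_smul]

/-- The completion of a pre-C⋆-algebra is a C⋆-algebra. -/
instance [IsScalarTower ℂ P P] [SMulCommClass ℂ P P] [StarModule ℂ P] :
    NonUnitalCStarAlgebra (CStarCompletion P) where

end Star

end CStarCompletion

/-! ### Finitely supported matrices over a C⋆-algebra -/

section FinMat

variable (A : Type*) [NonUnitalCStarAlgebra A]

/-- The entries of `M` outside the upper left `N × N` block vanish. -/
def MatrixBoundedBy {A : Type*} [Zero A] (N : ℕ) (M : Matrix ℕ ℕ A) : Prop :=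
  ∀ i j, N ≤ i ∨ N ≤ j → M i j = 0

/-- The `ℕ × ℕ` matrices with finitely many nonzero entries, as a subspace. -/
def finMatSubmodule : Submodule ℂ (Matrix ℕ ℕ A) where
  carrier := {M | ∃ N, MatrixBoundedBy N M}
  zero_mem' := ⟨0, fun _ _ _ => rfl⟩
  add_mem' := by
    rintro M M' ⟨N, h⟩ ⟨N', h'⟩
    refine ⟨max N N', fun i j hij => ?_⟩
    rw [Matrix.add_apply, h i j (by omega), h' i j (by omega), add_zero]
  smul_mem' := by
    rintro c M ⟨N, h⟩
    exact ⟨N, fun i j hij => by rw [Matrix.smul_apply, h i j hij, smul_zero]⟩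

/-- The `*`-algebra `M_∞(A)` of `ℕ × ℕ` matrices over `A` with finitely many nonzero entries. -/
def FinMat : Type _ := finMatSubmodule A

namespace FinMat

instance : AddCommGroup (FinMat A) := inferInstanceAs (AddCommGroup (finMatSubmodule A))

instance : Module ℂ (FinMat A) := inferInstanceAs (Module ℂ (finMatSubmodule A))

variable {A}

/-- The underlying matrix. -/
def val (M : FinMat A) : Matrix ℕ ℕ A := Subtype.val (p := (· ∈ finMatSubmodule A)) M

theorem exists_bound (M : FinMat A) : ∃ N, MatrixBoundedBy N M.val :=
  Subtype.property (p := (· ∈ finMatSubmodule A)) M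

/-- A finitely supported matrix as an element of `M_∞(A)`. -/
def mk (M : Matrix ℕ ℕ A) (h : ∃ N, MatrixBoundedBy N M) : FinMat A :=
  (⟨M, h⟩ : finMatSubmodule A)

theorem mk_val (M : Matrix ℕ ℕ A) (h : ∃ N, MatrixBoundedBy N M) : (mk M h).val = M := rfl

/-- The matrix `M` is supported in its upper left `N × N` block. -/
def BoundedBy (N : ℕ) (M : FinMat A) : Prop := MatrixBoundedBy N M.val

theorem exists_boundedBy (M : FinMat A) : ∃ N, BoundedBy N M := M.exists_bound

theorem BoundedBy.mono {N N' : ℕ} {M : FinMat A} (h : BoundedBy N M) (hN : N ≤ N') :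
    BoundedBy N' M := fun i j hij => h i j (by omega)

theorem exists_boundedBy₂ (M M' : FinMat A) : ∃ N, BoundedBy N M ∧ BoundedBy N M' := by
  obtain ⟨N, h⟩ := M.exists_boundedBy
  obtain ⟨N', h'⟩ := M'.exists_boundedBy
  exact ⟨max N N', h.mono (by omega), h'.mono (by omega)⟩

theorem exists_boundedBy₃ (M M' M'' : FinMat A) :
    ∃ N, BoundedBy N M ∧ BoundedBy N M' ∧ BoundedBy N M'' := by
  obtain ⟨N, h, h'⟩ := M.exists_boundedBy₂ M'
  obtain ⟨N', h''⟩ := M''.exists_boundedBy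
  exact ⟨max N N', h.mono (by omega), h'.mono (by omega), h''.mono (by omega)⟩

@[ext]
theorem ext {M M' : FinMat A} (h : ∀ i j, M.val i j = M'.val i j) : M = M' :=
  Subtype.ext (funext fun i => funext fun j => h i j)

@[simp] theorem zero_val : (0 : FinMat A).val = 0 := rfl
@[simp] theorem add_val (M M' : FinMat A) : (M + M').val = M.val + M'.val := rfl
@[simp] theorem smul_val (c : ℂ) (M : FinMat A) : (c • M).val = c • M.val := rfl

theorem BoundedBy.add {N : ℕ} {M M' : FinMat A} (h : BoundedBy N M) (h' : BoundedBy N M') :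
    BoundedBy N (M + M') := fun i j hij => by
  rw [add_val, Matrix.add_apply, h i j hij, h' i j hij, add_zero]

theorem finsum_eq {N : ℕ} {M : Matrix ℕ ℕ A} (h : MatrixBoundedBy N M) (M' : Matrix ℕ ℕ A)
    (i j : ℕ) : ∑ᶠ k, M i k * M' k j = ∑ k : Fin N, M i k * M' k j := by
  rw [Fin.sum_univ_eq_sum_range (fun k => M i k * M' k j) N]
  refine finsum_eq_sum_of_support_subset _ fun k hk => ?_
  by_contra hk'
  refine hk ?_
  simp only [Finset.coe_range, Set.mem_Iio, not_lt] at hk'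
  simp only [h i k (Or.inr hk'), zero_mul]

/-- Matrix multiplication. -/
instance : Mul (FinMat A) where
  mul M M' := mk (Matrix.of fun i j => ∑ᶠ k, M.val i k * M'.val k j) <| by
    obtain ⟨N, h, h'⟩ := M.exists_boundedBy₂ M'
    refine ⟨N, fun i j hij => ?_⟩
    refine (finsum_eq h M'.val i j).trans ?_
    refine Finset.sum_eq_zero fun k _ => ?_
    rcases hij with hi | hj
    · rw [h i k (Or.inl hi), zero_mul]
    · rw [h' k j (Or.inr hj), mul_zero]

theorem mul_val (M M' : FinMat A) (i j : ℕ) : (M * M').val i j = ∑ᶠ k, M.val i k * M'.val k j := rfl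

theorem BoundedBy.mul {N : ℕ} {M M' : FinMat A} (h : BoundedBy N M) (h' : BoundedBy N M') :
    BoundedBy N (M * M') := fun i j hij => by
  rw [mul_val, finsum_eq h]
  refine Finset.sum_eq_zero fun k _ => ?_
  rcases hij with hi | hj
  · rw [h i k (Or.inl hi), zero_mul]
  · rw [h' k j (Or.inr hj), mul_zero]

/-- Conjugate transpose. -/
instance : Star (FinMat A) where
  star M := mk (Matrix.of fun i j => star (M.val j i)) <| by
    obtain ⟨N, h⟩ := M.exists_boundedBy
    exact ⟨N, fun i j hij => (congrArg star (h j i hij.symm)).trans (star_zero A)⟩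

theorem star_val (M : FinMat A) (i j : ℕ) : (star M).val i j = star (M.val j i) := rfl

theorem BoundedBy.star {N : ℕ} {M : FinMat A} (h : BoundedBy N M) : BoundedBy N (star M) :=
  fun i j hij => by rw [star_val, h j i hij.symm, star_zero]

/-- The upper left `N × N` block of `M`. -/
def block (N : ℕ) : FinMat A →ₗ[ℂ] CStarMatrix (Fin N) (Fin N) A where
  toFun M := CStarMatrix.ofMatrix fun i j => M.val i j
  map_add' _ _ := rfl
  map_smul' _ _ := rfl

theorem block_apply (N : ℕ) (M : FinMat A) (i j : Fin N) : block N M i j = M.val i j := rfl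

theorem block_mul {N : ℕ} {M : FinMat A} (h : BoundedBy N M) (M' : FinMat A) :
    block N (M * M') = block N M * block N M' := by
  ext i j
  rw [block_apply, mul_val, finsum_eq h, CStarMatrix.mul_apply]
  rfl

theorem block_star (N : ℕ) (M : FinMat A) : block N (star M) = star (block N M) := rfl

theorem block_inj {N : ℕ} {M M' : FinMat A} (h : BoundedBy N M) (h' : BoundedBy N M')
    (hb : block N M = block N M') : M = M' := by
  ext i j
  by_cases hij : i < N ∧ j < N
  · exact congrFun (congrFun hb ⟨i, hij.1⟩) ⟨j, hij.2⟩
  · rw [h i j (by omega), h' i j (by omega)]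

instance : NonUnitalRing (FinMat A) where
  __ := (inferInstance : AddCommGroup (FinMat A))
  zero_mul M := by
    obtain ⟨N, h⟩ := M.exists_boundedBy
    have h0 : BoundedBy N (0 : FinMat A) := fun _ _ _ => rfl
    exact block_inj (h0.mul h) h0 (by rw [block_mul h0, map_zero, zero_mul])
  mul_zero M := by
    obtain ⟨N, h⟩ := M.exists_boundedBy
    have h0 : BoundedBy N (0 : FinMat A) := fun _ _ _ => rfl
    exact block_inj (h.mul h0) h0 (by rw [block_mul h, map_zero, mul_zero])
  mul_assoc M M' M'' := by
    obtain ⟨N, h, h', h''⟩ := exists_boundedBy₃ M M' M''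
    refine block_inj ((h.mul h').mul h'') (h.mul (h'.mul h'')) ?_
    rw [block_mul (h.mul h'), block_mul h, block_mul h, block_mul h', mul_assoc]
  left_distrib M M' M'' := by
    obtain ⟨N, h, h', h''⟩ := exists_boundedBy₃ M M' M''
    refine block_inj (h.mul (h'.add h'')) ((h.mul h').add (h.mul h'')) ?_
    rw [block_mul h, map_add, map_add, block_mul h, block_mul h, mul_add]
  right_distrib M M' M'' := by
    obtain ⟨N, h, h', h''⟩ := exists_boundedBy₃ M M' M''
    refine block_inj ((h.add h').mul h'') ((h.mul h'').add (h'.mul h'')) ?_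
    rw [block_mul (h.add h'), map_add, map_add, block_mul h, block_mul h', add_mul]

instance : StarRing (FinMat A) where
  star_involutive M := by ext i j; rw [star_val, star_val, star_star]
  star_add M M' := by ext i j; simp [star_val]
  star_mul M M' := by
    obtain ⟨N, h, h'⟩ := exists_boundedBy₂ M M'
    refine block_inj (h.mul h').star (h'.star.mul h.star) ?_
    rw [block_star, block_mul h, block_mul h'.star, star_mul, block_star, block_star]

instance : StarModule ℂ (FinMat A) where
  star_smul c M := by ext i j; simp [star_val]

theorem BoundedBy.smul {N : ℕ} {M : FinMat A} (h : BoundedBy N M) (c : ℂ) :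
    BoundedBy N (c • M) := fun i j hij => by
  rw [smul_val, Matrix.smul_apply, h i j hij, smul_zero]

instance : IsScalarTower ℂ (FinMat A) (FinMat A) where
  smul_assoc c M M' := by
    obtain ⟨N, h, h'⟩ := exists_boundedBy₂ M M'
    refine block_inj ((h.smul c).mul h') ((h.mul h').smul c) ?_
    rw [smul_eq_mul, smul_eq_mul, block_mul (h.smul c), map_smul, map_smul, block_mul h,
      CStarMatrix.smul_mul]

instance : SMulCommClass ℂ (FinMat A) (FinMat A) where
  smul_comm c M M' := by
    obtain ⟨N, h, h'⟩ := exists_boundedBy₂ M M'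
    refine block_inj ((h.mul h').smul c) (h.mul (h'.smul c)) ?_
    rw [smul_eq_mul, smul_eq_mul, block_mul h, map_smul, map_smul, block_mul h,
      CStarMatrix.mul_smul]

/-- An `N × N` matrix, extended by zero. -/
def pad (N : ℕ) (X : CStarMatrix (Fin N) (Fin N) A) : FinMat A :=
  mk (Matrix.of fun i j => if h : i < N ∧ j < N then X ⟨i, h.1⟩ ⟨j, h.2⟩ else 0)
    ⟨N, fun i j hij => dif_neg (by omega)⟩

theorem boundedBy_pad {N : ℕ} (X : CStarMatrix (Fin N) (Fin N) A) : BoundedBy N (pad N X) :=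
  fun i j hij => dif_neg (by omega)

theorem block_pad {N : ℕ} (X : CStarMatrix (Fin N) (Fin N) A) : block N (pad N X) = X := by
  ext i j
  exact dif_pos ⟨i.2, j.2⟩

theorem pad_block {N : ℕ} {M : FinMat A} (h : BoundedBy N M) : pad N (block N M) = M :=
  block_inj (boundedBy_pad _) h (block_pad _)

/-- Extension by zero from `N × N` to `N' × N'` matrices, for `N ≤ N'`. -/
def padHom {N N' : ℕ} (hN : N ≤ N') :
    CStarMatrix (Fin N) (Fin N) A →⋆ₙₐ[ℂ] CStarMatrix (Fin N') (Fin N') A where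
  toFun X := block N' (pad N X)
  map_smul' c X := by
    rw [MonoidHom.id_apply, ← map_smul]
    congr 1
    exact block_inj (boundedBy_pad _) ((boundedBy_pad _).smul c)
      (by rw [map_smul, block_pad, block_pad])
  map_zero' := by
    rw [← map_zero (block (A := A) N), pad_block (fun _ _ _ => rfl), map_zero]
  map_add' X Y := by
    rw [← map_add]
    congr 1
    exact block_inj (boundedBy_pad _) ((boundedBy_pad _).add (boundedBy_pad _))
      (by rw [map_add, block_pad, block_pad, block_pad])
  map_mul' X Y := by
    rw [← block_mul ((boundedBy_pad X).mono hN)]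
    congr 1
    exact block_inj (boundedBy_pad _) ((boundedBy_pad _).mul (boundedBy_pad _))
      (by rw [block_mul (boundedBy_pad X), block_pad, block_pad, block_pad])
  map_star' X := by
    rw [← block_star]
    congr 1
    exact block_inj (boundedBy_pad _) (boundedBy_pad _).star
      (by rw [block_star, block_pad, block_pad])

attribute [local instance] CStarAlgebra.spectralOrder CStarAlgebra.spectralOrderedRing

theorem norm_block_eq {N N' : ℕ} {M : FinMat A} (h : BoundedBy N M) (hN : N ≤ N') :
    ‖block N' M‖ = ‖block N M‖ := by
  have hinj : Function.Injective (padHom (A := A) hN) := fun X Y hXY => by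
    have := block_inj ((boundedBy_pad X).mono hN) ((boundedBy_pad Y).mono hN) hXY
    rw [← block_pad X, this, block_pad]
  have := NonUnitalStarAlgHom.norm_map (padHom (A := A) hN) hinj (block N M)
  rw [← this]
  change _ = ‖block N' (pad N (block N M))‖
  rw [pad_block h]

/-- The C⋆-norm of a finitely supported matrix: the norm in `M_N(A)` of any block that contains
its support. -/
instance : Norm (FinMat A) := ⟨fun M => ‖block M.exists_boundedBy.choose M‖⟩

theorem norm_eq {N : ℕ} {M : FinMat A} (h : BoundedBy N M) : ‖M‖ = ‖block N M‖ := by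
  have h' := M.exists_boundedBy.choose_spec
  change ‖block M.exists_boundedBy.choose M‖ = _
  rw [← norm_block_eq h' (le_max_left _ N), ← norm_block_eq h (le_max_right _ N)]

theorem normedSpaceCore : NormedSpace.Core ℂ (FinMat A) where
  norm_nonneg M := norm_nonneg (block M.exists_boundedBy.choose M)
  norm_smul c M := by
    obtain ⟨N, h⟩ := M.exists_boundedBy
    rw [norm_eq h, norm_eq (h.smul c), map_smul, norm_smul]
  norm_triangle M M' := by
    obtain ⟨N, h, h'⟩ := exists_boundedBy₂ M M'
    rw [norm_eq h, norm_eq h', norm_eq (h.add h'), map_add]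
    exact norm_add_le _ _
  norm_eq_zero_iff M := by
    obtain ⟨N, h⟩ := M.exists_boundedBy
    rw [norm_eq h, norm_eq_zero]
    refine ⟨fun h0 => block_inj h (fun _ _ _ => rfl) (by rw [h0, map_zero]), ?_⟩
    rintro rfl
    exact map_zero _

instance : NormedAddCommGroup (FinMat A) := NormedAddCommGroup.ofCore normedSpaceCore

instance : NormedSpace ℂ (FinMat A) := NormedSpace.ofCore normedSpaceCore

instance : NonUnitalNormedRing (FinMat A) where
  __ := (inferInstance : NormedAddCommGroup (FinMat A))
  __ := (inferInstance : NonUnitalRing (FinMat A))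
  norm_mul_le M M' := by
    obtain ⟨N, h, h'⟩ := exists_boundedBy₂ M M'
    rw [norm_eq h, norm_eq h', norm_eq (h.mul h'), block_mul h]
    exact norm_mul_le _ _

instance : CStarRing (FinMat A) where
  norm_mul_self_le M := by
    obtain ⟨N, h⟩ := M.exists_boundedBy
    rw [norm_eq h, norm_eq (h.star.mul h), block_mul h.star, block_star,
      CStarRing.norm_star_mul_self]


/-- The matrix whose row `2 i + r` is the row `i` of `M`, the other rows being zero
(`M ↦ V_r M` for the isometry `V_r : δ_i ↦ δ_{2 i + r}`). -/
def spreadRows (r : Fin 2) : FinMat A →ₗ[ℂ] FinMat A where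
  toFun M := mk (Matrix.of fun i j => if i % 2 = r then M.val (i / 2) j else 0) <| by
    obtain ⟨N, h⟩ := M.exists_boundedBy
    refine ⟨2 * N, fun i j hij => ?_⟩
    change (if i % 2 = r then M.val (i / 2) j else 0) = 0
    rw [h (i / 2) j (by omega), ite_self]
  map_add' M M' := by
    ext i j
    change (if i % 2 = r then M.val (i / 2) j + M'.val (i / 2) j else 0) =
      (if i % 2 = r then M.val (i / 2) j else 0) + (if i % 2 = r then M'.val (i / 2) j else 0)
    split_ifs <;> simp
  map_smul' c M := by
    ext i j
    change (if i % 2 = r then c • M.val (i / 2) j else 0) =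
      c • (if i % 2 = r then M.val (i / 2) j else 0)
    split_ifs <;> simp

theorem spreadRows_val (r : Fin 2) (M : FinMat A) (i j : ℕ) :
    (spreadRows r M).val i j = if i % 2 = r then M.val (i / 2) j else 0 := rfl

theorem spreadRows_mul (r : Fin 2) (M M' : FinMat A) :
    spreadRows r (M * M') = spreadRows r M * M' := by
  ext i j
  simp only [spreadRows_val, mul_val]
  split_ifs <;> simp

theorem star_spreadRows_mul_self (r : Fin 2) (M M' : FinMat A) :
    star (spreadRows r M) * spreadRows r M' = star M * M' := by
  ext i j
  simp only [mul_val, star_val, spreadRows_val]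
  have hinj : Function.Injective fun m : ℕ => 2 * m + (r : ℕ) := fun a b h => by
    simp only at h; omega
  have hr := r.2
  have h := finsum_mem_range (f := fun k : ℕ => star (if k % 2 = r then M.val (k / 2) i else 0) *
    (if k % 2 = r then M'.val (k / 2) j else 0)) hinj
  rw [finsum_mem_def, Set.indicator_eq_self.mpr] at h
  · rw [h]
    refine finsum_congr fun m => ?_
    have h1 : (2 * m + (r : ℕ)) % 2 = r := by omega
    have h2 : (2 * m + (r : ℕ)) / 2 = m := by omega
    simp only [h1, h2, if_true]
  · intro k hk
    refine ⟨k / 2, ?_⟩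
    by_contra hne
    refine hk ?_
    have : k % 2 ≠ r := fun h' => hne (by simp only; omega)
    simp only [this, if_false, mul_zero]

theorem star_spreadRows_mul_of_ne {r s : Fin 2} (hrs : r ≠ s) (M M' : FinMat A) :
    star (spreadRows r M) * spreadRows s M' = 0 := by
  ext i j
  simp only [mul_val, star_val, spreadRows_val]
  refine finsum_eq_zero_of_forall_eq_zero fun k => ?_
  by_cases h : k % 2 = r
  · have : k % 2 ≠ s := fun h' => hrs (Fin.ext (h.symm.trans h'))
    simp only [this, if_false, mul_zero]
  · simp only [h, if_false, star_zero, zero_mul]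

theorem isometry_spreadRows (r : Fin 2) : Isometry (spreadRows (A := A) r) :=
  AddMonoidHomClass.isometry_of_norm _ fun M => by
    have h1 := CStarRing.norm_star_mul_self (x := spreadRows r M)
    rw [star_spreadRows_mul_self, CStarRing.norm_star_mul_self] at h1
    exact ((mul_self_inj (norm_nonneg _) (norm_nonneg _)).mp h1).symm

theorem star_spread (r : Fin 2) (M : FinMat A) :
    star (spreadRows r (star (spreadRows r (star M)))) =
      spreadRows r (star (spreadRows r M)) := by
  ext i j
  simp only [star_val, spreadRows_val]
  split_ifs <;> simp

/-- The matrix with `a` in the upper left corner and zeros elsewhere. -/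
def corner (a : A) : FinMat A := pad 1 (CStarMatrix.ofMatrix fun _ _ => a)

end FinMat

end FinMat

/-! ### The stabilization -/

/-- The stabilization `A ⊗ K`, with `K` the compact operators on `ℓ²(ℕ)`: the C⋆-completion of
`M_∞(A) = A ⊙ M_∞(ℂ)`, that is, the C⋆-inductive limit of `A → M_2(A) → M_3(A) → ⋯`. -/
def Stabilization (A : Type*) [NonUnitalCStarAlgebra A] : Type _ := CStarCompletion (FinMat A)

namespace Stabilization

variable {A : Type*} [NonUnitalCStarAlgebra A]

instance : NonUnitalCStarAlgebra (Stabilization A) :=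
  inferInstanceAs (NonUnitalCStarAlgebra (CStarCompletion (FinMat A)))

/-- The inclusion of `M_∞(A)` in `A ⊗ K`. -/
def of : FinMat A → Stabilization A := CStarCompletion.of (FinMat A)

/-- The identification of `A` with the top left corner of `A ⊗ K`. -/
def corner (a : A) : Stabilization A := of (FinMat.corner a)

/-- Left multiplication on `A ⊗ K` by the isometry `V_r : δ_i ↦ δ_{2 i + r}` of `ℓ²(ℕ)`. -/
def spreadRows (r : Fin 2) : Stabilization A → Stabilization A :=
  CStarCompletion.extend (FinMat.spreadRows r)

theorem spreadRows_of (r : Fin 2) (M : FinMat A) :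
    spreadRows r (of M) = of (FinMat.spreadRows r M) :=
  CStarCompletion.extend_of (FinMat.isometry_spreadRows r) M

theorem continuous_spreadRows (r : Fin 2) : Continuous (spreadRows (A := A) r) :=
  CStarCompletion.continuous_extend _

@[elab_as_elim]
theorem induction_on {p : Stabilization A → Prop} (x : Stabilization A)
    (hc : IsClosed {x | p x}) (h : ∀ M, p (of M)) : p x :=
  CStarCompletion.induction_on x hc h

@[elab_as_elim]
theorem induction_on₂ {p : Stabilization A → Stabilization A → Prop} (x y : Stabilization A)
    (hc : IsClosed {q : Stabilization A × Stabilization A | p q.1 q.2})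
    (h : ∀ M M', p (of M) (of M')) : p x y :=
  CStarCompletion.induction_on₂ x y hc h

theorem of_mul (M M' : FinMat A) : of (M * M') = of M * of M' := CStarCompletion.of_mul M M'
theorem of_star (M : FinMat A) : of (star M) = star (of M) := CStarCompletion.of_star M
theorem of_add (M M' : FinMat A) : of (M + M') = of M + of M' :=
  map_add (CStarCompletion.of (FinMat A)) M M'
theorem of_zero : of (0 : FinMat A) = 0 := map_zero (CStarCompletion.of (FinMat A))

theorem spreadRows_add (r : Fin 2) (x y : Stabilization A) :
    spreadRows r (x + y) = spreadRows r x + spreadRows r y := by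
  have hV := continuous_spreadRows (A := A) r
  induction x, y using induction_on₂ with
  | hc => exact isClosed_eq (by fun_prop) (by fun_prop)
  | h M M' => simp only [spreadRows_of, ← of_add, map_add]

theorem spreadRows_mul (r : Fin 2) (x y : Stabilization A) :
    spreadRows r (x * y) = spreadRows r x * y := by
  have hV := continuous_spreadRows (A := A) r
  induction x, y using induction_on₂ with
  | hc => exact isClosed_eq (by fun_prop) (by fun_prop)
  | h M M' => simp only [spreadRows_of, ← of_mul, FinMat.spreadRows_mul]

theorem star_spreadRows_mul_self (r : Fin 2) (x y : Stabilization A) :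
    star (spreadRows r x) * spreadRows r y = star x * y := by
  have hV := continuous_spreadRows (A := A) r
  induction x, y using induction_on₂ with
  | hc => exact isClosed_eq (by fun_prop) (by fun_prop)
  | h M M' => simp only [spreadRows_of, ← of_mul, ← of_star, FinMat.star_spreadRows_mul_self]

theorem star_spreadRows_mul_of_ne {r s : Fin 2} (hrs : r ≠ s) (x y : Stabilization A) :
    star (spreadRows r x) * spreadRows s y = 0 := by
  have hV := continuous_spreadRows (A := A) r
  have hV' := continuous_spreadRows (A := A) s
  induction x, y using induction_on₂ with
  | hc => exact isClosed_eq (by fun_prop) (by fun_prop)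
  | h M M' =>
    simp only [spreadRows_of, ← of_mul, ← of_star, FinMat.star_spreadRows_mul_of_ne hrs, of_zero]

/-- The endomorphism `x ↦ V_r x V_r⋆` of `A ⊗ K`. -/
def spread (r : Fin 2) (x : Stabilization A) : Stabilization A :=
  spreadRows r (star (spreadRows r (star x)))

theorem continuous_spread (r : Fin 2) : Continuous (spread (A := A) r) := by
  have hV := continuous_spreadRows (A := A) r
  unfold spread
  fun_prop

theorem spread_add (r : Fin 2) (x y : Stabilization A) :
    spread r (x + y) = spread r x + spread r y := by
  simp only [spread, star_add, spreadRows_add]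

theorem spread_mul (r : Fin 2) (x y : Stabilization A) :
    spread r (x * y) = spread r x * spread r y := by
  simp only [spread]
  rw [← spreadRows_mul, star_spreadRows_mul_self, star_star, star_mul, spreadRows_mul, star_mul,
    star_star]

theorem star_spread (r : Fin 2) (x : Stabilization A) : star (spread r x) = spread r (star x) := by
  have hV := continuous_spread (A := A) r
  induction x using induction_on with
  | hc => exact isClosed_eq (by fun_prop) (by fun_prop)
  | h M =>
    simp only [spread, spreadRows_of, ← of_star, FinMat.star_spread, star_star]

theorem spread_mul_of_ne {r s : Fin 2} (hrs : r ≠ s) (x y : Stabilization A) :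
    spread r x * spread s y = 0 := by
  have h : spread r x = spread r (star (star x)) := by rw [star_star]
  rw [h, ← star_spread]
  exact star_spreadRows_mul_of_ne hrs _ _

end Stabilization


/-! ### Comparison of positive elements -/

section Comparison

variable {B : Type*} [NonUnitalCStarAlgebra B]

/-- `a` is a positive element: `a = y⋆ y` for some `y`. -/
def IsPosElem (a : B) : Prop := ∃ y, a = star y * y

/-- Murray-von Neumann equivalence `a ∼ b`. -/
def MvNEquiv (a b : B) : Prop := ∃ x, a = star x * x ∧ b = x * star x

/-- `a` is Cuntz smaller than `b`: there are `d_n` with `d_n⋆ b d_n → a`. -/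
def CuntzLE (a b : B) : Prop :=
  ∃ d : ℕ → B, Tendsto (fun n => star (d n) * b * d n) atTop (𝓝 a)

/-- `a` and `b` are stably approximately unitarily equivalent: there are unitaries `u_n` in the
unitization of `B ⊗ K` with `u_n⋆ a u_n → b`, where `B` is the top left corner of `B ⊗ K`. -/
def StablyApproxUnitarilyEquiv (a b : B) : Prop :=
  ∃ u : ℕ → unitary (Unitization ℂ (Stabilization B)),
    Tendsto (fun n => star (u n : Unitization ℂ (Stabilization B)) *
      (Stabilization.corner a : Unitization ℂ (Stabilization B)) * u n) atTop
      (𝓝 (Stabilization.corner b : Unitization ℂ (Stabilization B)))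

variable (B) in
/-- Property (I): whenever `e` is a positive contraction with `e x = x e = x`, the elements
`x⋆ x + e` and `x x⋆ + e` are stably approximately unitarily equivalent. -/
def PropertyI : Prop :=
  ∀ x e : B, IsPosElem e → ‖e‖ ≤ 1 → e * x = x → x * e = x →
    StablyApproxUnitarilyEquiv (star x * x + e) (x * star x + e)

theorem cuntzLE_iff {a b : B} :
    CuntzLE a b ↔ ∀ ε > 0, ∃ d, ‖star d * b * d - a‖ < ε := by
  constructor
  · rintro ⟨d, hd⟩ ε hε
    obtain ⟨n, hn⟩ := (Metric.tendsto_nhds.mp hd ε hε).exists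
    exact ⟨d n, by rwa [← dist_eq_norm]⟩
  · intro h
    choose d hd using fun n : ℕ => h (1 / ((n : ℝ) + 1)) (by positivity)
    refine ⟨d, tendsto_iff_norm_sub_tendsto_zero.mpr ?_⟩
    exact squeeze_zero (fun _ => norm_nonneg _) (fun n => (hd n).le)
      tendsto_one_div_add_atTop_nhds_zero_nat

theorem CuntzLE.refl (a : B) : CuntzLE a a := by
  let _ := CStarAlgebra.spectralOrder B
  have := CStarAlgebra.spectralOrderedRing B
  have hl := CStarAlgebra.increasingApproximateUnit B
  have := hl.neBot
  refine cuntzLE_iff.mpr fun ε hε => ?_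
  have h1 := Metric.tendsto_nhds.mp (hl.tendsto_mul_left a) (ε / 2) (by positivity)
  have h2 := Metric.tendsto_nhds.mp (hl.tendsto_mul_right a) (ε / 2) (by positivity)
  obtain ⟨x, hx1, hx2, hx3, hx4⟩ :=
    (h1.and (h2.and (hl.eventually_norm.and hl.eventually_star_eq))).exists
  rw [dist_eq_norm] at hx1 hx2
  refine ⟨x, ?_⟩
  have : star x * a * x - a = (x * a - a) * x + (a * x - a) := by
    rw [hx4, sub_mul]; abel
  rw [this]
  calc ‖(x * a - a) * x + (a * x - a)‖ ≤ ‖x * a - a‖ * ‖x‖ + ‖a * x - a‖ :=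
        (norm_add_le _ _).trans (by gcongr; exact norm_mul_le _ _)
    _ ≤ ‖x * a - a‖ * 1 + ‖a * x - a‖ := by gcongr
    _ < ε := by linarith

theorem CuntzLE.trans {a b c : B} (hab : CuntzLE a b) (hbc : CuntzLE b c) : CuntzLE a c := by
  rw [cuntzLE_iff] at *
  intro ε hε
  obtain ⟨d, hd⟩ := hab (ε / 2) (by positivity)
  obtain ⟨f, hf⟩ := hbc (ε / 2 / (‖d‖ * ‖d‖ + 1)) (by positivity)
  refine ⟨f * d, ?_⟩
  have : star (f * d) * c * (f * d) - a =
      star d * (star f * c * f - b) * d + (star d * b * d - a) := by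
    rw [star_mul]; noncomm_ring
  rw [this]
  have h1 : ‖star d * (star f * c * f - b) * d‖ ≤ (‖d‖ * ‖d‖) * ‖star f * c * f - b‖ := by
    calc _ ≤ ‖star d‖ * ‖star f * c * f - b‖ * ‖d‖ :=
          (norm_mul_le _ _).trans (by gcongr; exact norm_mul_le _ _)
      _ = _ := by rw [norm_star]; ring
  have h2 : (‖d‖ * ‖d‖) * ‖star f * c * f - b‖ ≤ ε / 2 := by
    have h3 : ‖star f * c * f - b‖ * (‖d‖ * ‖d‖ + 1) < ε / 2 :=
      (lt_div_iff₀ (by positivity)).mp hf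
    nlinarith [norm_nonneg (star f * c * f - b)]
  linarith [norm_add_le (star d * (star f * c * f - b) * d) (star d * b * d - a)]

theorem MvNEquiv.symm {a b : B} (h : MvNEquiv a b) : MvNEquiv b a := by
  obtain ⟨x, hx, hx'⟩ := h
  exact ⟨star x, by rw [star_star, hx'], by rw [star_star, hx]⟩

theorem IsPosElem.exists_sqrt {a : B} (h : IsPosElem a) : ∃ s, IsSelfAdjoint s ∧ a = s * s := by
  let _ := CStarAlgebra.spectralOrder B
  have := CStarAlgebra.spectralOrderedRing B
  exact CStarAlgebra.nonneg_iff_exists_isSelfAdjoint_and_eq_mul_self.mp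
    (CStarAlgebra.nonneg_iff_eq_star_mul_self.mpr h)

theorem MvNEquiv.cuntzLE {a b : B} (h : MvNEquiv a b) : CuntzLE a b := by
  obtain ⟨x, ha, rfl⟩ := h
  obtain ⟨s, hs, hs'⟩ := IsPosElem.exists_sqrt ⟨x, ha⟩
  refine cuntzLE_iff.mpr fun ε hε => ?_
  let δ := ε / 3
  have hδ : 0 < δ := by positivity
  let f : ℝ → ℝ := fun t => t / (t * t + δ)
  have hf : Continuous f :=
    continuous_id.div (by fun_prop) fun t => by nlinarith [mul_self_nonneg t]
  have hf0 : f 0 = 0 := zero_div _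
  have hk : star (cfcₙ f s) = cfcₙ f s := (cfcₙ_predicate f s : IsSelfAdjoint _).star_eq
  have hid : cfcₙ (fun t : ℝ => t) s = s := cfcₙ_id' ℝ s
  refine ⟨x * cfcₙ f s, ?_⟩
  have h1 : star (x * cfcₙ f s) * (x * star x) * (x * cfcₙ f s) - a =
      cfcₙ f s * (s * s) * (s * s) * cfcₙ f s - s * s := by
    rw [star_mul, hk, ← hs', ha]; noncomm_ring
  have h2 : cfcₙ f s * (s * s) * (s * s) * cfcₙ f s - s * s =
      cfcₙ (fun t => f t * (t * t) * (t * t) * f t - t * t) s := by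
    rw [cfcₙ_sub _ _ s (by fun_prop) (by simp) (by fun_prop) (by simp),
      cfcₙ_mul _ _ s (by fun_prop) (by simp) (by fun_prop) hf0,
      cfcₙ_mul (fun t => f t * (t * t)) _ s (by fun_prop) (by simp) (by fun_prop) (by simp),
      cfcₙ_mul f _ s (by fun_prop) hf0 (by fun_prop) (by simp),
      cfcₙ_mul (fun t => t) (fun t => t) s (by fun_prop) rfl (by fun_prop) rfl, hid]
  rw [h1, h2]
  refine (norm_cfcₙ_le (c := 2 * δ) fun t _ => ?_).trans_lt (by simp only [δ]; linarith)
  have ht : 0 ≤ t * t := mul_self_nonneg t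
  have h3 : f t * (t * t) * (t * t) * f t - t * t =
      -((t * t) * (2 * (t * t) + δ) / ((t * t + δ) * (t * t + δ))) * δ := by
    simp only [f]
    field_simp
    ring
  have h4 : (t * t) * (2 * (t * t) + δ) / ((t * t + δ) * (t * t + δ)) ≤ 2 := by
    rw [div_le_iff₀ (by positivity)]
    nlinarith [mul_nonneg ht hδ.le]
  rw [h3, norm_mul, norm_neg, Real.norm_of_nonneg (by positivity), Real.norm_of_nonneg hδ.le]
  exact mul_le_mul_of_nonneg_right h4 hδ.le

variable (B) in
/-- The positive elements of `B`, preordered by Cuntz comparison. -/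
def PosElem : Type _ := {a : B // IsPosElem a}

instance : Preorder (PosElem B) where
  le a b := CuntzLE a.1 b.1
  le_refl a := CuntzLE.refl a.1
  le_trans _ _ _ := CuntzLE.trans

end Comparison

/-! ### The Cuntz semigroup -/

namespace Stabilization

variable {A : Type*} [NonUnitalCStarAlgebra A]

/-- The orthogonal sum `a ⊕ b = V_0 a V_0⋆ + V_1 b V_1⋆` in `A ⊗ K`. -/
def orthSum (a b : Stabilization A) : Stabilization A := spread 0 a + spread 1 b

theorem orthSum_mul (a b c d : Stabilization A) :
    orthSum a b * orthSum c d = orthSum (a * c) (b * d) := by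
  simp only [orthSum, add_mul, mul_add, spread_mul,
    spread_mul_of_ne (show (0 : Fin 2) ≠ 1 by decide),
    spread_mul_of_ne (show (1 : Fin 2) ≠ 0 by decide), add_zero, zero_add]

theorem star_orthSum (a b : Stabilization A) : star (orthSum a b) = orthSum (star a) (star b) := by
  simp only [orthSum, star_add, star_spread]

theorem isPosElem_orthSum {a b : Stabilization A} (ha : IsPosElem a) (hb : IsPosElem b) :
    IsPosElem (orthSum a b) := by
  obtain ⟨y, rfl⟩ := ha
  obtain ⟨z, rfl⟩ := hb
  exact ⟨orthSum y z, by rw [star_orthSum, orthSum_mul]⟩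

theorem cuntzLE_orthSum {a b a' b' : Stabilization A} (ha : CuntzLE a a') (hb : CuntzLE b b') :
    CuntzLE (orthSum a b) (orthSum a' b') := by
  obtain ⟨d, hd⟩ := ha
  obtain ⟨e, he⟩ := hb
  refine ⟨fun n => orthSum (d n) (e n), ?_⟩
  simp only [star_orthSum, orthSum_mul]
  exact (((continuous_spread 0).tendsto _).comp hd).add (((continuous_spread 1).tendsto _).comp he)

/-- A positive element `a` is Murray-von Neumann equivalent to `V_r a V_r⋆`. -/
theorem mvnEquiv_spread (r : Fin 2) {a : Stabilization A} (ha : IsPosElem a) :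
    MvNEquiv a (spread r a) := by
  obtain ⟨s, hs, rfl⟩ := ha.exists_sqrt
  refine ⟨spreadRows r s, by rw [star_spreadRows_mul_self, hs.star_eq], ?_⟩
  rw [spread, star_mul, hs.star_eq, spreadRows_mul, star_mul, hs.star_eq, spreadRows_mul]

theorem mvnEquiv_orthSum {a b a' b' : Stabilization A} (ha : MvNEquiv a a') (hb : MvNEquiv b b')
    (hab : a' * b' = 0) : MvNEquiv (orthSum a b) (a' + b') := by
  obtain ⟨x, rfl, rfl⟩ := ha
  obtain ⟨y, rfl, rfl⟩ := hb
  have h1 : x * star x * y = 0 := by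
    rw [← CStarRing.mul_star_self_eq_zero_iff, star_mul,
      show x * star x * y * (star y * star (x * star x)) =
        x * star x * (y * star y) * star (x * star x) by noncomm_ring, hab, zero_mul]
  have hxy : star x * y = 0 := by
    rw [← CStarRing.star_mul_self_eq_zero_iff, star_mul, star_star,
      show star y * x * (star x * y) = star y * (x * star x * y) by noncomm_ring, h1, mul_zero]
  have hyx : star y * x = 0 := by rw [← star_star x, ← star_mul, hxy, star_zero]
  have hz (r : Fin 2) : spreadRows r (0 : Stabilization A) = 0 := by
    simpa using spreadRows_mul r (0 : Stabilization A) 0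
  have key (r s : Fin 2) (u v : Stabilization A) : spreadRows r (star u) *
      star (spreadRows s (star v)) = spreadRows r (star (spreadRows s (star (star u * v)))) := by
    rw [star_mul (star u) v, star_star, spreadRows_mul s, star_mul, spreadRows_mul r]
  refine ⟨star (spreadRows 0 (star x)) + star (spreadRows 1 (star y)), ?_, ?_⟩
  · rw [star_add, star_star, star_star, add_mul, mul_add, mul_add, key, key, key, key, hxy, hyx]
    simp only [star_zero, hz, add_zero, zero_add]
    rfl
  · rw [star_add, star_star, star_star, add_mul, mul_add, mul_add, star_spreadRows_mul_self,
      star_spreadRows_mul_self, star_spreadRows_mul_of_ne (by decide),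
      star_spreadRows_mul_of_ne (by decide), star_star, star_star, add_zero, zero_add]

end Stabilization

/-- The Cuntz semigroup: the Cuntz equivalence classes of positive elements of `A ⊗ K`, ordered by
Cuntz comparison. -/
def CuntzSemigroup (A : Type*) [NonUnitalCStarAlgebra A] : Type _ :=
  Antisymmetrization (PosElem (Stabilization A)) (· ≤ ·)

namespace CuntzSemigroup

variable {A : Type*} [NonUnitalCStarAlgebra A]

instance : PartialOrder (CuntzSemigroup A) :=
  inferInstanceAs (PartialOrder (Antisymmetrization (PosElem (Stabilization A)) (· ≤ ·)))

/-- The class `[a]` of a positive element `a` of `A ⊗ K`. -/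
def mk (a : Stabilization A) (ha : IsPosElem a) : CuntzSemigroup A :=
  toAntisymmetrization (α := PosElem (Stabilization A)) (· ≤ ·) ⟨a, ha⟩

theorem mk_le_mk {a b : Stabilization A} (ha : IsPosElem a) (hb : IsPosElem b) :
    mk a ha ≤ mk b hb ↔ CuntzLE a b := Iff.rfl

/-- The addition `[a] + [b] = [a ⊕ b]`. -/
instance : Add (CuntzSemigroup A) where
  add := Quotient.map₂ (fun a b => ⟨Stabilization.orthSum a.1 b.1,
      Stabilization.isPosElem_orthSum a.2 b.2⟩)
    fun _ _ h _ _ h' => ⟨Stabilization.cuntzLE_orthSum h.1 h'.1,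
      Stabilization.cuntzLE_orthSum h.2 h'.2⟩

theorem mk_add_mk {a b : Stabilization A} (ha : IsPosElem a) (hb : IsPosElem b) :
    mk a ha + mk b hb =
      mk (Stabilization.orthSum a b) (Stabilization.isPosElem_orthSum ha hb) := rfl

/-- `[a] + [b] = [a' + b']` for all mutually orthogonal `a' ∼ a` and `b' ∼ b`; such `a'` and `b'`
exist, namely `V_0 a V_0⋆` and `V_1 b V_1⋆`. -/
theorem mk_add_mk_of_mvnEquiv {a b a' b' : Stabilization A} (ha : IsPosElem a) (hb : IsPosElem b)
    (haa' : MvNEquiv a a') (hbb' : MvNEquiv b b') (hab : a' * b' = 0) (h : IsPosElem (a' + b')) :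
    mk a ha + mk b hb = mk (a' + b') h :=
  le_antisymm (Stabilization.mvnEquiv_orthSum haa' hbb' hab).cuntzLE
    (Stabilization.mvnEquiv_orthSum haa' hbb' hab).symm.cuntzLE

end CuntzSemigroup

/-- The far below relation `x ≪ y` of an ordered set. -/
def FarBelow {S : Type*} [PartialOrder S] (x y : S) : Prop :=
  ∀ u : ℕ → S, Monotone u → ∀ s, IsLUB (Set.range u) s → y ≤ s → ∃ k, x ≤ u k

/-- Weak cancellation: `x + z ≪ y + z` implies `x ≤ y`. -/
def WeakCancellation (S : Type*) [PartialOrder S] [Add S] : Prop :=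
  ∀ x y z : S, FarBelow (x + z) (y + z) → x ≤ y

end

/-! Let `B = A ⊗ K`, let `D` be its unitization, and let `a`, `b`, `c` represent `x`, `y`, `z`. The
cut-downs `(b - 1/n)₊ ⊕ (c - 1/n)₊` increase to the supremum `[b] + [c]`, so the far below relation
yields `a ⊕ c ≼ (b - ε)₊ ⊕ (c - ε)₊` for some `ε > 0` (`exists_cuntzLE_orthSum_cutDown`). The gap
`ε` leaves room for local units `μ`, `κ` of the two cut-downs that still lie in the algebras
generated by `b` and `c` (`IsPosElem.exists_cutDown_units`).

Place `a`, `b` in one corner of `B` and `c` in an orthogonal one. The comparison gives `m_n` with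
`m_n⋆ m_n → a + c` and `(κ + μ) m_n = m_n`, so `T = 1 - κ - μ` kills `m_n`. With `ψ c ψ = 2 κ - κ²`
and `X_n = m_n ψ + T`, the products `X_n⋆ X_n` tend to `(2 κ - κ²) + T² = 1 - p`, where `p = 2 μ -
μ²`: adding `T` has absorbed `c`, and only a part of `b` is missing from the unit. On the other
side, `z_n = m_n a` is asymptotically orthogonal to `X_n`, while `z_n⋆ z_n → a³`.

Property (I) for `X_n` and `e = 1` compares the two defects. The polynomial `2 t - t²` sends `1 + s`
to `1 - s²`, hence unitaries of the stabilized algebra carry `1 - (1 - p)² = 2 p - p²` close to `1 -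
(X_n X_n⋆)²`, which is asymptotically the identity on `z_n` (`PropertyI.exists_tendsto_conj`). So
`z_n⋆ u_n⋆ (2 p - p²) u_n z_n → a³`. As `2 p - p² = θ² b θ²`, the factors `θ` bring the conjugating
elements back into `B`, which gives `a³ ≼ b` (`PropertyI.cuntzLE_cube`); finally `a ≼ a³`. -/

/-! ### Null sequences and the C⋆-identity. -/

/-- By the C⋆-identity `‖X y‖² = ‖y⋆ (X⋆ X) y‖`, so convergence of `X⋆ X` suffices; the `X n`
themselves need not converge. -/
theorem tendsto_mul_zero_of_tendsto_star_mul_self {D : Type*} [NonUnitalCStarAlgebra D]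
    {X y : ℕ → D} {q : D} (hX : Tendsto (fun n => star (X n) * X n) atTop (𝓝 q))
    (hy : Tendsto y atTop (𝓝 0)) : Tendsto (fun n => X n * y n) atTop (𝓝 0) := by
  have h1 : Tendsto (fun n => star (y n) * (star (X n) * X n) * y n) atTop (𝓝 (star 0 * q * 0)) :=
    (hy.star.mul hX).mul hy
  rw [mul_zero] at h1
  have h2 := h1.norm.sqrt
  rw [norm_zero, Real.sqrt_zero] at h2
  refine tendsto_zero_iff_norm_tendsto_zero.mpr (h2.congr fun n => ?_)
  rw [show star (y n) * (star (X n) * X n) * y n = star (X n * y n) * (X n * y n) by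
    rw [star_mul]; noncomm_ring, CStarRing.norm_star_mul_self, Real.sqrt_mul_self (norm_nonneg _)]

theorem isBoundedUnder_norm_of_tendsto_star_mul_self {D : Type*} [NonUnitalCStarAlgebra D]
    {z : ℕ → D} {q : D} (hz : Tendsto (fun n => star (z n) * z n) atTop (𝓝 q)) :
    IsBoundedUnder (· ≤ ·) atTop fun n => ‖z n‖ := by
  have h := hz.norm.sqrt.isBoundedUnder_le
  simpa only [CStarRing.norm_star_mul_self, Real.sqrt_mul_self (norm_nonneg _)] using h

/-- Conjugating a null sequence by a sequence `z` with `z⋆ z` convergent gives a null sequence. -/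
theorem tendsto_conj_zero_of_tendsto_star_mul_self {D : Type*} [NonUnitalCStarAlgebra D]
    {z y : ℕ → D} {q : D} (hz : Tendsto (fun n => star (z n) * z n) atTop (𝓝 q))
    (hy : Tendsto y atTop (𝓝 0)) : Tendsto (fun n => star (z n) * y n * z n) atTop (𝓝 0) := by
  have hb := isBoundedUnder_norm_of_tendsto_star_mul_self hz
  have hb' : IsBoundedUnder (· ≤ ·) atTop fun n => ‖star (z n)‖ := by simpa only [norm_star]
  exact (isBoundedUnder_le_mul_tendsto_zero hb' hy).zero_mul_isBoundedUnder_le hb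

/-! ### The top left corner as a hereditary subalgebra. -/

namespace FinMat

variable {A : Type*} [NonUnitalCStarAlgebra A]

theorem corner_val (a : A) (i j : ℕ) :
    (corner a).val i j = if i = 0 ∧ j = 0 then a else 0 := by
  change (if h : i < 1 ∧ j < 1 then _ else _) = _
  simp only [Nat.lt_one_iff]
  rfl

theorem corner_mul_val (q : A) (M : FinMat A) (i j : ℕ) :
    (corner q * M).val i j = if i = 0 then q * M.val 0 j else 0 := by
  rw [mul_val, finsum_eq_single _ 0 fun k hk => by rw [corner_val, if_neg (by tauto), zero_mul],
    corner_val]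
  split_ifs <;> simp_all

theorem mul_corner_val (q : A) (M : FinMat A) (i j : ℕ) :
    (M * corner q).val i j = if j = 0 then M.val i 0 * q else 0 := by
  rw [mul_val, finsum_eq_single _ 0 fun k hk => by rw [corner_val, if_neg (by tauto), mul_zero],
    corner_val]
  split_ifs <;> simp_all

theorem corner_mul_mul_corner (q q' : A) (M : FinMat A) :
    corner q * M * corner q' = corner (q * M.val 0 0 * q') := by
  ext i j
  rw [mul_corner_val, corner_mul_val, corner_val]
  split_ifs <;> simp_all

end FinMat

namespace Stabilization

variable {A : Type*} [NonUnitalCStarAlgebra A]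

/-- The embedding of `A` as the top left corner of `A ⊗ K`. -/
noncomputable def cornerHom (A : Type*) [NonUnitalCStarAlgebra A] : A →⋆ₙₐ[ℂ] Stabilization A where
  toFun := corner
  map_smul' c a := by
    refine Eq.trans (congrArg of ?_) (map_smul (CStarCompletion.of (FinMat A)) c (FinMat.corner a))
    ext i j
    simp [FinMat.corner_val]
  map_zero' := by
    refine Eq.trans (congrArg of ?_) of_zero
    ext i j
    simp [FinMat.corner_val]
  map_add' a b := by
    refine Eq.trans (congrArg of ?_) (of_add _ _)
    ext i j
    simp only [FinMat.corner_val, FinMat.add_val, Matrix.add_apply]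
    split_ifs <;> simp
  map_mul' a b := by
    refine Eq.trans (congrArg of ?_) (of_mul _ _)
    ext i j
    rw [FinMat.corner_mul_val, FinMat.corner_val, FinMat.corner_val]
    split_ifs <;> simp_all
  map_star' a := by
    refine Eq.trans (congrArg of ?_) (of_star _)
    ext i j
    rw [FinMat.star_val, FinMat.corner_val, FinMat.corner_val]
    split_ifs <;> simp_all

theorem cornerHom_apply (a : A) : cornerHom A a = corner a := rfl

theorem cornerHom_injective : Function.Injective (cornerHom A) := fun a b h => by
  have h1 : FinMat.corner a = FinMat.corner b := (CStarCompletion.of (FinMat A)).injective h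
  have h2 := congrArg (fun M => FinMat.val M 0 0) h1
  simpa [FinMat.corner_val] using h2

theorem norm_cornerHom (a : A) : ‖cornerHom A a‖ = ‖a‖ :=
  NonUnitalStarAlgHom.norm_map (cornerHom A) cornerHom_injective a

theorem isClosed_range_cornerHom : IsClosed (Set.range (cornerHom A)) :=
  (AddMonoidHomClass.isometry_of_norm _ norm_cornerHom).isClosedEmbedding.isClosed_range

/-- The top left corner is a hereditary subalgebra of `A ⊗ K`. -/
theorem exists_cornerHom_eq_mul_mul (q q' : A) (w : Stabilization A) :
    ∃ d, cornerHom A d = cornerHom A q * w * cornerHom A q' := by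
  induction w using induction_on with
  | hc =>
    -- The corner is the isometric image of a complete space, hence closed, so finitely supported
    -- matrices suffice; for these only the `(0, 0)` entry survives compression.
    exact isClosed_range_cornerHom.preimage
      (f := fun w => cornerHom A q * w * cornerHom A q') (by fun_prop)
  | h M =>
    refine ⟨q * M.val 0 0 * q', ?_⟩
    rw [cornerHom_apply, corner, ← FinMat.corner_mul_mul_corner, of_mul, of_mul]
    rfl

variable (A) in
/-- The embedding of `A` in the unitization of `A ⊗ K`. -/
noncomputable def unitizedCorner : A →⋆ₙₐ[ℂ] Unitization ℂ (Stabilization A) :=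
  (Unitization.inrNonUnitalStarAlgHom ℂ (Stabilization A)).comp (cornerHom A)

theorem unitizedCorner_apply (a : A) :
    unitizedCorner A a = (corner a : Unitization ℂ (Stabilization A)) := rfl

theorem norm_unitizedCorner (a : A) : ‖unitizedCorner A a‖ = ‖a‖ :=
  (Unitization.norm_inr _).trans (norm_cornerHom a)

theorem isometry_unitizedCorner : Isometry (unitizedCorner A) :=
  AddMonoidHomClass.isometry_of_norm _ norm_unitizedCorner

theorem exists_unitizedCorner_eq_mul_mul (q q' : A) (w : Unitization ℂ (Stabilization A)) :
    ∃ d, unitizedCorner A d = unitizedCorner A q * w * unitizedCorner A q' := by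
  obtain ⟨d, hd⟩ := exists_cornerHom_eq_mul_mul q q' w.snd
  -- The scalar part of `w` contributes the multiple of `q q'`, the part in `A ⊗ K` contributes `d`.
  refine ⟨w.fst • (q * q') + d, ?_⟩
  rw [map_add, map_smul, map_mul]
  have hw : unitizedCorner A q * w * unitizedCorner A q' =
      unitizedCorner A q * Unitization.inl w.fst * unitizedCorner A q' +
        unitizedCorner A q * (w.snd : Unitization ℂ (Stabilization A)) * unitizedCorner A q' := by
    rw [← add_mul, ← mul_add, Unitization.inl_fst_add_inr_snd_eq]
  rw [hw]
  congr 1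
  · rw [← Unitization.algebraMap_eq_inl, Algebra.algebraMap_eq_smul_one, mul_smul_comm, mul_one,
      smul_mul_assoc]
  · have := congrArg (Unitization.inr (R := ℂ)) hd
    rw [Unitization.inr_mul, Unitization.inr_mul] at this
    exact this

end Stabilization

/-! ### Property (I) with `e = 1`. -/

open Stabilization in
/-- If `X_n⋆ X_n → 1 - p` and `z_n` is asymptotically orthogonal to `X_n`, then property (I)
carries `2 p - p²` over to `1 - (X_n X_n⋆)²`, which dominates `z_n z_n⋆`. -/
theorem PropertyI.exists_tendsto_conj {D : Type*} [CStarAlgebra D] (hI : PropertyI D)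
    {X z : ℕ → D} {p s : D} (hX : Tendsto (fun n => star (X n) * X n) atTop (𝓝 (1 - p)))
    (hXz : Tendsto (fun n => star (X n) * z n) atTop (𝓝 0))
    (hz : Tendsto (fun n => star (z n) * z n) atTop (𝓝 s)) :
    ∃ u : ℕ → Unitization ℂ (Stabilization D), Tendsto (fun n => star (unitizedCorner D (z n)) *
      (star (u n) * unitizedCorner D (p + p - p * p) * u n) * unitizedCorner D (z n)) atTop
      (𝓝 (unitizedCorner D s)) := by
  set ι := unitizedCorner D
  have hι : Continuous ι := isometry_unitizedCorner.continuous
  -- Since `g(1 + s) = 1 - s²`, this turns `X X⋆ + 1` into a defect of `X X⋆` from the unit. It has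
  -- no constant term, so it is compatible with the embedding `ι`, which does not preserve the unit.
  let g (t : D) : D := t + t - t * t
  have hg : Continuous g := by fun_prop
  have hιg (t : D) : ι (g t) = ι t + ι t - ι t * ι t := by
    simp only [g, map_add, map_sub, map_mul]
  have hu (n : ℕ) : ∃ u : unitary (Unitization ℂ (Stabilization D)),
      ‖star (u : Unitization ℂ (Stabilization D)) * ι (g (star (X n) * X n + 1)) * u -
        ι (g (X n * star (X n) + 1))‖ < 1 / ((n : ℝ) + 1) := by
    have h1 : ‖(1 : D)‖ ≤ 1 := by
      rcases subsingleton_or_nontrivial D with h | h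
      · rw [Subsingleton.elim (1 : D) 0, norm_zero]; exact zero_le_one
      · exact CStarRing.norm_one.le
    obtain ⟨u, hu⟩ := hI (X n) 1 ⟨1, by simp⟩ h1 (one_mul _) (mul_one _)
    -- Polynomials are continuous, so the unitaries that relate the two elements also relate their
    -- images under `g`; conjugation commutes with squaring because `v v⋆ = 1`.
    have h2 := (hu.add hu).sub (hu.mul hu)
    have h3 := Metric.tendsto_nhds.mp h2 (1 / ((n : ℝ) + 1)) (by positivity)
    obtain ⟨k, hk⟩ := h3.exists
    refine ⟨u k, ?_⟩
    rw [dist_eq_norm] at hk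
    have hv := Unitary.mul_star_self_of_mem (u k).2
    rw [hιg, hιg]
    refine lt_of_eq_of_lt (congrArg norm (congrArg₂ (· - ·) ?_ rfl)) hk
    change _ = star (u k : Unitization ℂ (Stabilization D)) * ι (star (X n) * X n + 1) * u k +
      star (u k : Unitization ℂ (Stabilization D)) * ι (star (X n) * X n + 1) * u k -
      star (u k : Unitization ℂ (Stabilization D)) * ι (star (X n) * X n + 1) * u k *
      (star (u k : Unitization ℂ (Stabilization D)) * ι (star (X n) * X n + 1) * u k)
    generalize (u k : Unitization ℂ (Stabilization D)) = v at hv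
    generalize ι (star (X n) * X n + 1) = m
    rw [show star v * m * v * (star v * m * v) = star v * m * (v * star v) * m * v by
      noncomm_ring, hv]
    noncomm_ring
  choose u hu using hu
  refine ⟨fun n => u n, ?_⟩
  have hιz : Tendsto (fun n => star (ι (z n)) * ι (z n)) atTop (𝓝 (ι s)) := by
    simp only [← map_star, ← map_mul]
    exact (hι.tendsto s).comp hz
  have h1 : Tendsto (fun n => star (u n : Unitization ℂ (Stabilization D)) *
      ι (g (star (X n) * X n + 1)) * u n - ι (g (X n * star (X n) + 1))) atTop (𝓝 0) :=
    squeeze_zero_norm (fun n => (hu n).le) tendsto_one_div_add_atTop_nhds_zero_nat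
  have h2 : Tendsto (fun n => star (u n : Unitization ℂ (Stabilization D)) *
      ι (p + p - p * p - g (star (X n) * X n + 1)) * u n) atTop (𝓝 0) := by
    have h3 : Tendsto (fun n => ι (p + p - p * p - g (star (X n) * X n + 1))) atTop (𝓝 0) := by
      have h4 := (hι.tendsto _).comp
        (tendsto_const_nhds (x := p + p - p * p).sub ((hg.tendsto _).comp (hX.add_const 1)))
      -- Both sides of this difference equal `1 - (1 - p)²`.
      have h5 : p + p - p * p - g (1 - p + 1) = 0 := by simp only [g]; noncomm_ring
      rw [h5, map_zero] at h4
      exact h4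
    refine tendsto_zero_iff_norm_tendsto_zero.mpr
      ((tendsto_zero_iff_norm_tendsto_zero.mp h3).congr fun n => ?_)
    rw [CStarRing.norm_mul_coe_unitary]
    exact (CStarRing.norm_coe_unitary_mul (star (u n)) _).symm
  have h3 := tendsto_conj_zero_of_tendsto_star_mul_self hιz (h1.add h2 |>.trans (by rw [add_zero]))
  have h4 : Tendsto (fun n => star (ι (z n)) * ι (g (X n * star (X n) + 1)) * ι (z n)) atTop
      (𝓝 (ι s)) := by
    -- As `X X⋆ z → 0`, the correction in `z⋆ (1 - (X X⋆)²) z = z⋆ z - (X X⋆ z)⋆ (X X⋆ z)` vanishes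
    -- in the limit.
    have h5 := tendsto_mul_zero_of_tendsto_star_mul_self hX hXz
    have h6 := (hι.tendsto _).comp (hz.sub (h5.star.mul h5))
    rw [mul_zero, sub_zero] at h6
    refine h6.congr fun n => ?_
    simp only [Function.comp_apply, ← map_star, ← map_mul]
    congr 1
    simp only [g, star_mul, star_star]
    noncomm_ring
  have h5 := h3.add h4
  rw [zero_add] at h5
  refine h5.congr fun n => ?_
  rw [map_sub ι (p + p - p * p) (g (star (X n) * X n + 1))]
  generalize ι (g (X n * star (X n) + 1)) = y''
  generalize ι (g (star (X n) * X n + 1)) = y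
  generalize ι (p + p - p * p) = y'
  noncomm_ring

/-! ### Cuntz comparison through functional calculus. -/

section Comparison

variable {B : Type*} [NonUnitalCStarAlgebra B]

/-- The elements below a fixed `b` form a norm closed set; this is what makes `[b] + [c]` the least
upper bound of the classes of the cut-downs. -/
theorem CuntzLE.of_tendsto {a b : B} {v : ℕ → B} (hv : Tendsto v atTop (𝓝 a))
    (h : ∀ n, CuntzLE (v n) b) : CuntzLE a b := by
  refine cuntzLE_iff.mpr fun ε hε => ?_
  obtain ⟨n, hn⟩ := (Metric.tendsto_nhds.mp hv (ε / 2) (by positivity)).exists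
  obtain ⟨d, hd⟩ := cuntzLE_iff.mp (h n) (ε / 2) (by positivity)
  refine ⟨d, ?_⟩
  rw [dist_eq_norm] at hn
  linarith [norm_sub_le_norm_sub_add_norm_sub (star d * b * d) (v n) a]

theorem cuntzLE_cfcₙ {s : B} {f g : ℝ → ℝ} (hf : Continuous f) (hg : Continuous g)
    (hf0 : f 0 = 0) (hg0 : g 0 = 0)
    (h : ∀ δ > 0, ∃ φ : ℝ → ℝ, Continuous φ ∧ φ 0 = 0 ∧ ∀ t, |φ t * g t * φ t - f t| ≤ δ) :
    CuntzLE (cfcₙ f s) (cfcₙ g s) := by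
  refine cuntzLE_iff.mpr fun ε hε => ?_
  obtain ⟨φ, hφ, hφ0, hφ'⟩ := h (ε / 2) (by positivity)
  refine ⟨cfcₙ φ s, ?_⟩
  have hk : star (cfcₙ φ s) = cfcₙ φ s := (cfcₙ_predicate φ s : IsSelfAdjoint _).star_eq
  rw [hk, ← cfcₙ_mul φ g s (by fun_prop) hφ0 (by fun_prop) hg0,
    ← cfcₙ_mul (fun t => φ t * g t) φ s (by fun_prop) (by simp [hφ0]) (by fun_prop) hφ0,
    ← cfcₙ_sub _ _ s (by fun_prop) (by simp [hφ0]) (by fun_prop) hf0]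
  refine (norm_cfcₙ_le (c := ε / 2) fun t _ => ?_).trans_lt (by linarith)
  exact hφ' t

theorem IsPosElem.isSelfAdjoint {a : B} (h : IsPosElem a) : IsSelfAdjoint a := by
  obtain ⟨y, rfl⟩ := h
  exact IsSelfAdjoint.star_mul_self y

theorem IsSelfAdjoint.isPosElem_mul_self {s : B} (h : IsSelfAdjoint s) : IsPosElem (s * s) :=
  ⟨s, by rw [h.star_eq]⟩

theorem IsPosElem.cfcₙ_max {a : B} (h : IsPosElem a) : cfcₙ (fun t : ℝ => max t 0) a = a := by
  let _ := CStarAlgebra.spectralOrder B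
  have := CStarAlgebra.spectralOrderedRing B
  have ha : 0 ≤ a := CStarAlgebra.nonneg_iff_eq_star_mul_self.mpr h
  have h1 : Set.EqOn (fun t : ℝ => max t 0) (fun t => t) (quasispectrum ℝ a) := fun t ht =>
    max_eq_left (quasispectrum_nonneg_of_nonneg a ha t ht)
  rw [cfcₙ_congr h1, cfcₙ_id' ℝ a h.isSelfAdjoint]

/-- Needed because the cancellation argument produces `a³`, the limit of `(m_n a)⋆ (m_n a)`, and not
`a`. -/
theorem IsPosElem.cuntzLE_cube {a : B} (h : IsPosElem a) : CuntzLE a (a * a * a) := by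
  have h1 : a * a * a = cfcₙ (fun t : ℝ => max t 0 * max t 0 * max t 0) a := by
    rw [cfcₙ_mul (fun t : ℝ => max t 0 * max t 0) _ a (by fun_prop) (by simp) (by fun_prop)
      (by simp), cfcₙ_mul _ _ a (by fun_prop) (by simp) (by fun_prop) (by simp), h.cfcₙ_max]
  rw [h1]
  nth_rw 1 [← h.cfcₙ_max]
  refine cuntzLE_cfcₙ (by fun_prop) (by fun_prop) (by simp) (by simp) fun δ hδ => ?_
  -- A regularized `1 / s`, so that `φ² s³` is close to `s`. Regularizing with `δ²` puts the
  -- transition at `s ∼ δ`, where the error is of order `δ`.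
  refine ⟨fun t => max t 0 / (max t 0 * max t 0 + δ * δ), ?_, by simp, fun t => ?_⟩
  · exact Continuous.div (by fun_prop) (by fun_prop) fun t => by positivity
  · have hs : 0 ≤ max t 0 := le_max_right _ _
    beta_reduce
    generalize max t 0 = s at hs ⊢
    have h2 : s / (s * s + δ * δ) * (s * s * s) * (s / (s * s + δ * δ)) - s =
        -(s * (δ * δ) * (2 * (s * s) + δ * δ) / ((s * s + δ * δ) * (s * s + δ * δ))) := by
      field_simp
      ring
    rw [h2, abs_neg, abs_of_nonneg (by positivity), div_le_iff₀ (by positivity)]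
    have h3 : 0 ≤ δ * (s * s + δ * δ) := by positivity
    have h4 : 0 ≤ (s - δ) * (s - δ) := mul_self_nonneg _
    nlinarith [mul_nonneg h3 h4, mul_nonneg hs hδ.le, pow_nonneg hδ.le 3, pow_nonneg hδ.le 4,
      mul_nonneg hs (pow_nonneg hδ.le 4)]

/-- `(a - ε)₊` -/
noncomputable def cutDown (ε : ℝ) (a : B) : B := cfcₙ (fun t : ℝ => max (t - ε) 0) a

theorem isPosElem_cfcₙ {a : B} {f : ℝ → ℝ} (hf : Continuous f) (hf0 : f 0 = 0)
    (h : ∀ t, 0 ≤ f t) : IsPosElem (cfcₙ f a) := by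
  have h1 : cfcₙ f a = cfcₙ (fun t => √(f t)) a * cfcₙ (fun t => √(f t)) a := by
    rw [← cfcₙ_mul _ _ a (by fun_prop) (by simp [hf0]) (by fun_prop) (by simp [hf0])]
    simp only [Real.mul_self_sqrt (h _)]
  rw [h1]
  exact (cfcₙ_predicate _ a : IsSelfAdjoint _).isPosElem_mul_self

theorem isPosElem_cutDown {ε : ℝ} (hε : 0 ≤ ε) (a : B) : IsPosElem (cutDown ε a) :=
  isPosElem_cfcₙ (by fun_prop) (by simpa) fun _ => le_max_right _ _

theorem norm_cutDown_sub_le {ε : ℝ} (hε : 0 ≤ ε) {a : B} (h : IsPosElem a) :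
    ‖cutDown ε a - a‖ ≤ ε := by
  nth_rw 2 [← h.cfcₙ_max]
  rw [cutDown, ← cfcₙ_sub _ _ a (by fun_prop) (by simpa) (by fun_prop) (by simp)]
  refine norm_cfcₙ_le fun t _ => ?_
  rw [Real.norm_eq_abs, abs_le]
  constructor <;> rcases le_total (t - ε) 0 with h1 | h1 <;> rcases le_total t 0 with h2 | h2 <;>
    simp only [h1, h2, max_eq_left, max_eq_right] <;> linarith

theorem cuntzLE_cutDown {ε ε' : ℝ} (hε : 0 ≤ ε') (h : ε' ≤ ε) (a : B) :
    CuntzLE (cutDown ε a) (cutDown ε' a) := by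
  refine cuntzLE_cfcₙ (by fun_prop) (by fun_prop) (by simp; linarith) (by simpa) fun δ hδ => ?_
  have hm (t : ℝ) : 0 < max (max (t - ε') 0) δ := lt_max_of_lt_right hδ
  -- With `x = (t - ε)₊ ≤ y = (t - ε')₊`, the product is `x y / max y δ`: exactly `x` where `y ≥ δ`,
  -- and within `x ≤ y ≤ δ` of it elsewhere.
  refine ⟨fun t => √(max (t - ε) 0 / max (max (t - ε') 0) δ),
    Real.continuous_sqrt.comp (Continuous.div (by fun_prop) (by fun_prop) fun t => (hm t).ne'),
    by simp [show -ε ≤ 0 by linarith], fun t => ?_⟩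
  have h1 : 0 ≤ max (t - ε) 0 := le_max_right _ _
  have h2 : max (t - ε) 0 ≤ max (t - ε') 0 := max_le_max (by linarith) le_rfl
  have h3 := hm t
  have h4 : √(max (t - ε) 0 / max (max (t - ε') 0) δ) * max (t - ε') 0 *
      √(max (t - ε) 0 / max (max (t - ε') 0) δ) =
      max (t - ε) 0 / max (max (t - ε') 0) δ * max (t - ε') 0 := by
    rw [mul_right_comm, Real.mul_self_sqrt (by positivity)]
  rw [h4]
  generalize max (t - ε) 0 = x at *
  generalize max (t - ε') 0 = y at *
  rcases le_total δ y with h5 | h5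
  · rw [max_eq_left h5, div_mul_cancel₀ _ (by linarith), sub_self, abs_zero]
    exact hδ.le
  · rw [max_eq_right h5, abs_le]
    have h6 : x / δ * y ≤ x := by
      rw [div_mul_eq_mul_div, div_le_iff₀ hδ]; gcongr
    have h7 : 0 ≤ x / δ * y := mul_nonneg (div_nonneg h1 hδ.le) (h1.trans h2)
    constructor <;> linarith

theorem IsPosElem.cutDown_cuntzLE {ε : ℝ} (hε : 0 ≤ ε) {a : B} (h : IsPosElem a) :
    CuntzLE (cutDown ε a) a := by
  have h0 : cutDown 0 a = a := by
    simpa [cutDown] using h.cfcₙ_max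
  simpa only [h0] using cuntzLE_cutDown le_rfl hε a

/-- Elements of the commutative C⋆-algebra generated by `a`: a square root `β` of `(a - ε)₊`, a
local unit `κ` for `β`, and multipliers `ψ`, `θ` that carry `a` to `2 κ - κ²` and, for
`π = 2 κ - κ²`, to `2 π - π²`. -/
theorem IsPosElem.exists_cutDown_units {a : B} (h : IsPosElem a) {ε : ℝ} (hε : 0 < ε) :
    ∃ β κ ψ θ : B, IsSelfAdjoint β ∧ IsSelfAdjoint κ ∧ IsSelfAdjoint ψ ∧ IsSelfAdjoint θ ∧
      β * β = cutDown ε a ∧ κ * β = β ∧ ψ * a * ψ = κ + κ - κ * κ ∧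
      θ * θ * a * (θ * θ) = (κ + κ - κ * κ) + (κ + κ - κ * κ) -
        (κ + κ - κ * κ) * (κ + κ - κ * κ) := by
  -- A ramp from `0` at `ε / 2` to `1` at `ε`: it is a unit on the support of `(t - ε)₊` and
  -- vanishes near `0`. Further down, `1 - p = (1 - k)²` and `1 - r = (1 - p)²`.
  let k (t : ℝ) : ℝ := min 1 (max 0 (2 * t / ε - 1))
  -- A denominator bounded away from `0`; it agrees with `t` wherever a function vanishing up to `ε
  -- / 2` can be nonzero.
  let m (t : ℝ) : ℝ := max t (ε / 2)
  let p (t : ℝ) : ℝ := k t + k t - k t * k t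
  let r (t : ℝ) : ℝ := p t + p t - p t * p t
  let b (t : ℝ) : ℝ := √(max (t - ε) 0)
  have hm (t : ℝ) : 0 < m t := lt_max_of_lt_right (by positivity)
  have hkc : Continuous k := by fun_prop
  have hmc : Continuous m := by fun_prop
  have hpc : Continuous p := by fun_prop
  have hrc : Continuous r := by fun_prop
  have hbc : Continuous b := by fun_prop
  have hk0 (t : ℝ) : 0 ≤ k t := le_min zero_le_one (le_max_left _ _)
  have hk1 (t : ℝ) : k t ≤ 1 := min_le_left _ _
  have hp0 (t : ℝ) : 0 ≤ p t := by simp only [p]; nlinarith [hk0 t, hk1 t]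
  have hp1 (t : ℝ) : p t ≤ 1 := by simp only [p]; nlinarith [sq_nonneg (1 - k t)]
  have hr0 (t : ℝ) : 0 ≤ r t := by simp only [r]; nlinarith [hp0 t, hp1 t]
  have hk (t : ℝ) (ht : t ≤ ε / 2) : k t = 0 := by
    have : 2 * t / ε - 1 ≤ 0 := by
      rw [sub_nonpos, div_le_one hε]; linarith
    simp only [k, max_eq_left this, min_eq_right zero_le_one]
  have hk' (t : ℝ) (ht : ε ≤ t) : k t = 1 := by
    have : 1 ≤ 2 * t / ε - 1 := by
      rw [le_sub_iff_add_le, le_div_iff₀ hε]; linarith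
    exact min_eq_left (this.trans (le_max_right _ _))
  have hk00 : k 0 = 0 := hk 0 (by positivity)
  have hp00 : p 0 = 0 := by simp [p, hk00]
  have hr00 : r 0 = 0 := by simp [r, hp00]
  have hb00 : b 0 = 0 := by simp [b, hε.le]
  have hquot (g : ℝ → ℝ) (hg : ∀ t ≤ ε / 2, g t = 0) (t : ℝ) : g t / m t * t = g t := by
    rcases le_total t (ε / 2) with ht | ht
    · rw [hg t ht, zero_div, zero_mul]
    · have : m t = t := max_eq_left ht
      rw [this, div_mul_cancel₀ _ (by linarith)]
  have hid : cfcₙ (fun t : ℝ => t) a = a := cfcₙ_id' ℝ a h.isSelfAdjoint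
  have hP : cfcₙ p a = cfcₙ k a + cfcₙ k a - cfcₙ k a * cfcₙ k a := by
    rw [cfcₙ_sub (fun t => k t + k t) _ a (by fun_prop) (by simp [hk00]) (by fun_prop)
      (by simp [hk00]), cfcₙ_add _ _ a (by fun_prop) hk00 (by fun_prop) hk00,
      cfcₙ_mul _ _ a (by fun_prop) hk00 (by fun_prop) hk00]
  have hR : cfcₙ r a = cfcₙ p a + cfcₙ p a - cfcₙ p a * cfcₙ p a := by
    rw [cfcₙ_sub (fun t => p t + p t) _ a (by fun_prop) (by simp [hp00]) (by fun_prop)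
      (by simp [hp00]), cfcₙ_add _ _ a (by fun_prop) hp00 (by fun_prop) hp00,
      cfcₙ_mul _ _ a (by fun_prop) hp00 (by fun_prop) hp00]
  let w (g : ℝ → ℝ) (t : ℝ) : ℝ := √(g t / m t)
  have hwc {g : ℝ → ℝ} (hg : Continuous g) : Continuous (w g) :=
    Real.continuous_sqrt.comp (hg.div hmc fun t => (hm t).ne')
  have hw0 {g : ℝ → ℝ} (hg : g 0 = 0) : w g 0 = 0 := by simp [w, hg]
  have hw (g : ℝ → ℝ) (hgc : Continuous g) (hg0 : ∀ t, 0 ≤ g t) (hg : ∀ t ≤ ε / 2, g t = 0) :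
      cfcₙ (w g) a * a * cfcₙ (w g) a = cfcₙ g a := by
    have hc := hwc hgc
    have h0 : w g 0 = 0 := hw0 (hg 0 (by positivity))
    nth_rw 2 [← hid]
    rw [← cfcₙ_mul _ _ a (by fun_prop) h0 (by fun_prop) rfl,
      ← cfcₙ_mul (fun t => w g t * t) _ a (by fun_prop) (by simp) (by fun_prop) h0]
    congr 1
    funext t
    rw [mul_right_comm, Real.mul_self_sqrt (div_nonneg (hg0 t) (hm t).le), hquot g hg]
  have hrw : Continuous (w r) := hwc hrc
  -- `θ` is a further square root, so that `θ²` is the multiplier: the later argument needs two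
  -- factors `θ` on each side of `b`.
  refine ⟨cfcₙ b a, cfcₙ k a, cfcₙ (w p) a, cfcₙ (fun t => √(w r t)) a, cfcₙ_predicate _ a,
    cfcₙ_predicate _ a, cfcₙ_predicate _ a, cfcₙ_predicate _ a, ?_, ?_, ?_, ?_⟩
  · rw [← cfcₙ_mul _ _ a (by fun_prop) hb00 (by fun_prop) hb00, cutDown]
    congr 1
    funext t
    exact Real.mul_self_sqrt (le_max_right _ _)
  · rw [← cfcₙ_mul _ _ a (by fun_prop) hk00 (by fun_prop) hb00]
    congr 1
    funext t
    rcases le_total ε t with ht | ht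
    · rw [hk' t ht, one_mul]
    · simp only [b, max_eq_right (sub_nonpos.mpr ht), Real.sqrt_zero, mul_zero]
  · rw [hw p hpc hp0 fun t ht => by simp [p, hk t ht], hP]
  · have h1 : cfcₙ (fun t => √(w r t)) a * cfcₙ (fun t => √(w r t)) a = cfcₙ (w r) a := by
      rw [← cfcₙ_mul _ _ a (by fun_prop) (by simp [hw0 hr00]) (by fun_prop) (by simp [hw0 hr00])]
      simp only [Real.mul_self_sqrt (Real.sqrt_nonneg _), w]
    rw [h1, hw r hrc hr0 fun t ht => by simp [r, p, hk t ht], hR, hP]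

/-! ### The cancellation argument. -/

open Stabilization in
/-- Cancellation of `c` from `a + c ≼ (b - ε)₊ + (c - ε)₊`: here `G⋆ G` is the right-hand side, `κ`
and `μ` are the local units of `(c - ε)₊` and `(b - ε)₊`. -/
theorem PropertyI.cuntzLE_cube (hI : PropertyI (Unitization ℂ B)) {a b c G κ μ ψ θ : B}
    (ha : IsSelfAdjoint a) (hG : IsSelfAdjoint G) (hκ : IsSelfAdjoint κ) (hμ : IsSelfAdjoint μ)
    (hψ : IsSelfAdjoint ψ) (hθ : IsSelfAdjoint θ) (hca : c * a = 0) (hψa : ψ * a = 0)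
    (hκμ : κ * μ = 0) (hκG : (κ + μ) * G = G) (hψc : ψ * c * ψ = κ + κ - κ * κ)
    (hθb : θ * θ * b * (θ * θ) = (μ + μ - μ * μ) + (μ + μ - μ * μ) -
      (μ + μ - μ * μ) * (μ + μ - μ * μ)) (h : CuntzLE (a + c) (G * G)) :
    CuntzLE (a * a * a) b := by
  obtain ⟨d, hd⟩ := h
  have hμκ : μ * κ = 0 := by
    rw [← hμ.star_eq, ← hκ.star_eq, ← star_mul, hκμ, star_zero]
  let j := Unitization.inrNonUnitalStarAlgHom ℂ B
  have hj : Isometry j := AddMonoidHomClass.isometry_of_norm _ fun x => Unitization.norm_inr x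
  let m (n : ℕ) : B := G * d n
  have hm : Tendsto (fun n => star (m n) * m n) atTop (𝓝 (a + c)) := by
    refine hd.congr fun n => ?_
    simp only [m, star_mul, hG.star_eq]
    noncomm_ring
  have hjm (v w q : B) (hq : star v * (a + c) * w = q) :
      Tendsto (fun n => star (j (m n * v)) * j (m n * w)) atTop (𝓝 (j q)) := by
    have h1 := (hj.continuous.tendsto _).comp ((hm.const_mul (star v)).mul_const w)
    rw [hq] at h1
    refine h1.congr fun n => ?_
    simp only [Function.comp_apply, ← map_star, ← map_mul, star_mul]
    congr 1
    noncomm_ring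
  let T : Unitization ℂ B := 1 - j κ - j μ
  have hT : star T = T := by
    simp only [T, star_sub, star_one, ← map_star, hκ.star_eq, hμ.star_eq]
  have hTm (n : ℕ) (v : B) : T * j (m n * v) = 0 := by
    have h1 : T * j (m n * v) = j (m n * v) - (j κ + j μ) * j (m n * v) := by
      simp only [T]; noncomm_ring
    have h2 : (κ + μ) * (m n * v) = m n * v := by
      simp only [m]
      rw [← mul_assoc, ← mul_assoc, hκG]
    rw [h1, ← map_add, ← map_mul, h2, sub_self]
  have hmT (n : ℕ) (v : B) : star (j (m n * v)) * T = 0 := by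
    rw [← hT, ← star_mul, hTm, star_zero]
  -- The first summand has `X⋆ X` close to `ψ c ψ = 2 κ - κ²`; `T` fills up what is missing from the
  -- unit except `2 μ - μ²`. The cross terms vanish because `T m_n = 0`.
  let X (n : ℕ) : Unitization ℂ B := j (m n * ψ) + T
  have hX : Tendsto (fun n => star (X n) * X n) atTop (𝓝 (1 - j (μ + μ - μ * μ))) := by
    have h1 := (hjm ψ ψ (κ + κ - κ * κ) (by
      rw [hψ.star_eq, mul_add, hψa, zero_add, hψc])).add_const (T * T)
    have h2 : j (κ + κ - κ * κ) + T * T = 1 - j (μ + μ - μ * μ) := by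
      have h3 : j κ * j μ = 0 := by rw [← map_mul, hκμ, map_zero]
      have h4 : j μ * j κ = 0 := by rw [← map_mul, hμκ, map_zero]
      have h5 : T * T = 1 - (j κ + j κ - j κ * j κ) - (j μ + j μ - j μ * j μ) +
        j κ * j μ + j μ * j κ := by simp only [T]; noncomm_ring
      rw [h5, h3, h4]
      simp only [map_add, map_sub, map_mul]
      noncomm_ring
    rw [h2] at h1
    refine h1.congr fun n => ?_
    simp only [X]
    rw [star_add, hT, add_mul, mul_add, mul_add, hTm, hmT, add_zero, zero_add]
  have hXz : Tendsto (fun n => star (X n) * j (m n * a)) atTop (𝓝 0) := by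
    -- Asymptotic orthogonality comes from `ψ (a + c) a = 0`.
    have h1 := hjm ψ a 0 (by
      rw [hψ.star_eq, mul_add, hψa, zero_add, mul_assoc, hca, mul_zero])
    rw [map_zero] at h1
    refine h1.congr fun n => ?_
    simp only [X]
    rw [star_add, hT, add_mul, hTm, add_zero]
  have hz := hjm a a (a * a * a) (by rw [ha.star_eq, mul_add, add_mul, mul_assoc a c, hca, mul_zero,
    add_zero])
  obtain ⟨u, hu⟩ := hI.exists_tendsto_conj hX hXz hz
  -- The outer `θ` compresses `u_n z_n` to the corner, which is hereditary, and so removes the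
  -- stabilization.
  choose e he using fun n => exists_unitizedCorner_eq_mul_mul (j θ) (j (m n * a)) (u n)
  -- The inner `θ` removes the adjoined unit, since `B` is an ideal of its unitization.
  have hθe (n : ℕ) : ∃ f, j f = j θ * e n := by
    refine ⟨(e n).fst • θ + θ * (e n).snd, ?_⟩
    rw [map_add, map_smul, map_mul]
    have h1 : j θ * e n = j θ * Unitization.inl (e n).fst + j θ * j (e n).snd := by
      rw [← mul_add]
      exact congrArg _ (Unitization.inl_fst_add_inr_snd_eq (e n)).symm
    rw [h1, ← Unitization.algebraMap_eq_inl, Algebra.algebraMap_eq_smul_one, mul_smul_comm, mul_one]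
  choose f hf using hθe
  refine ⟨f, ?_⟩
  have hi : Isometry fun x => unitizedCorner (Unitization ℂ B) (j x) :=
    isometry_unitizedCorner.comp hj
  refine (hi.isEmbedding.isInducing.tendsto_nhds_iff).mpr (hu.congr fun n => ?_)
  simp only [Function.comp_apply]
  have h1 : j (μ + μ - μ * μ) + j (μ + μ - μ * μ) - j (μ + μ - μ * μ) * j (μ + μ - μ * μ) =
      j (θ * θ * b * (θ * θ)) := by
    rw [hθb]; simp only [map_add, map_sub, map_mul]
  have h2 : star (j θ) = j θ := by rw [← map_star, hθ.star_eq]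
  have h3 : j (star (f n) * b * f n) = star (e n) * (j θ * j b * j θ) * e n := by
    rw [map_mul, map_mul, map_star, hf, star_mul, h2]
    noncomm_ring
  have h4 : j (θ * θ * b * (θ * θ)) = j θ * (j θ * j b * j θ) * j θ := by
    simp only [map_mul]
    noncomm_ring
  have h5 : star (unitizedCorner (Unitization ℂ B) (j θ)) = unitizedCorner _ (j θ) := by
    rw [← map_star, h2]
  rw [h1, h3, h4]
  generalize j θ * j b * j θ = w
  rw [map_mul _ (star (e n) * w), map_mul _ (star (e n)), map_star, he, map_mul _ (j θ * w),
    map_mul _ (j θ), star_mul, star_mul, h5]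
  simp only [mul_assoc]

end Comparison

/-! ### From the far below relation to cut-downs. -/

namespace CuntzSemigroup

variable {A : Type*} [NonUnitalCStarAlgebra A]

theorem exists_cuntzLE_orthSum_cutDown {a b c : Stabilization A} (ha : IsPosElem a)
    (hb : IsPosElem b) (hc : IsPosElem c) (h : FarBelow (mk a ha + mk c hc) (mk b hb + mk c hc)) :
    ∃ ε > 0, CuntzLE (Stabilization.orthSum a c)
      (Stabilization.orthSum (cutDown ε b) (cutDown ε c)) := by
  -- The cut-down levels decrease to `0`, so the classes increase; the far below relation is tested
  -- on this one sequence.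
  let η (n : ℕ) : ℝ := 1 / ((n : ℝ) + 1)
  have hη (n : ℕ) : 0 < η n := by simp only [η]; positivity
  have hη0 : Tendsto η atTop (𝓝 0) := tendsto_one_div_add_atTop_nhds_zero_nat
  have hpos (n : ℕ) := Stabilization.isPosElem_orthSum (isPosElem_cutDown (hη n).le b)
    (isPosElem_cutDown (hη n).le c)
  have hlim {x : Stabilization A} (hx : IsPosElem x) :
      Tendsto (fun n => cutDown (η n) x) atTop (𝓝 x) :=
    tendsto_iff_norm_sub_tendsto_zero.mpr
      (squeeze_zero (fun _ => norm_nonneg _) (fun n => norm_cutDown_sub_le (hη n).le hx) hη0)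
  have hmono : Monotone fun n => mk _ (hpos n) := fun n n' hn => by
    have : η n' ≤ η n := one_div_le_one_div_of_le (by positivity) (by gcongr)
    exact Stabilization.cuntzLE_orthSum (cuntzLE_cutDown (hη _).le this b)
      (cuntzLE_cutDown (hη _).le this c)
  have hlub : IsLUB (Set.range fun n => mk _ (hpos n)) (mk b hb + mk c hc) := by
    constructor
    · rintro _ ⟨n, rfl⟩
      exact Stabilization.cuntzLE_orthSum (hb.cutDown_cuntzLE (hη n).le)
        (hc.cutDown_cuntzLE (hη n).le)
    · intro s hs
      induction s using Quotient.inductionOn with | h s => ?_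
      refine CuntzLE.of_tendsto (v := fun n => Stabilization.orthSum (cutDown (η n) b)
        (cutDown (η n) c)) ?_ fun n => hs ⟨n, rfl⟩
      exact (((Stabilization.continuous_spread 0).tendsto _).comp (hlim hb)).add
        (((Stabilization.continuous_spread 1).tendsto _).comp (hlim hc))
  obtain ⟨k, hk⟩ := h _ hmono _ hlub le_rfl
  exact ⟨η k, hη k, hk⟩

end CuntzSemigroup

/-! ### Passage to orthogonal corners of `A ⊗ K`. -/

namespace Stabilization

variable {A : Type*} [NonUnitalCStarAlgebra A]

theorem spread_sub (r : Fin 2) (x y : Stabilization A) :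
    spread r (x - y) = spread r x - spread r y := by
  rw [eq_sub_iff_add_eq, ← spread_add, sub_add_cancel]

theorem isSelfAdjoint_spread (r : Fin 2) {x : Stabilization A} (hx : IsSelfAdjoint x) :
    IsSelfAdjoint (spread r x) := by
  rw [isSelfAdjoint_iff, star_spread, hx.star_eq]

/-- The images of `a`, `b` under `spread 0` are orthogonal to that of `c` under `spread 1`, as the
cancellation argument requires; Murray-von Neumann equivalence with the originals undoes the move at
the end. -/
theorem cuntzLE_of_cuntzLE_orthSum_cutDown (hA : PropertyI (Unitization ℂ (Stabilization A)))
    {a b c : Stabilization A} (ha : IsPosElem a) (hb : IsPosElem b) (hc : IsPosElem c) {ε : ℝ}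
    (hε : 0 < ε) (h : CuntzLE (orthSum a c) (orthSum (cutDown ε b) (cutDown ε c))) :
    CuntzLE a b := by
  obtain ⟨β, μ, -, θ, hβ, hμ, -, hθ, hβ2, hμβ, -, hθb⟩ := hb.exists_cutDown_units hε
  obtain ⟨γ, κ, ψ, -, hγ, hκ, hψ, -, hγ2, hκγ, hψc, -⟩ := hc.exists_cutDown_units hε
  have h01 (x y : Stabilization A) : spread 0 x * spread 1 y = 0 :=
    spread_mul_of_ne (by decide) x y
  have h10 (x y : Stabilization A) : spread 1 x * spread 0 y = 0 :=
    spread_mul_of_ne (by decide) x y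
  have key : CuntzLE (spread 0 a * spread 0 a * spread 0 a) (spread 0 b) := by
    -- `G = β ⊕ γ` is a square root of the sum of the cut-downs.
    refine hA.cuntzLE_cube (c := spread 1 c) (G := orthSum β γ) (κ := spread 1 κ)
      (μ := spread 0 μ) (ψ := spread 1 ψ) (θ := spread 0 θ)
      (isSelfAdjoint_spread 0 ha.isSelfAdjoint)
      ((isSelfAdjoint_spread 0 hβ).add (isSelfAdjoint_spread 1 hγ))
      (isSelfAdjoint_spread 1 hκ) (isSelfAdjoint_spread 0 hμ) (isSelfAdjoint_spread 1 hψ)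
      (isSelfAdjoint_spread 0 hθ) (h10 _ _) (h10 _ _) (h10 _ _) ?_ ?_ ?_ ?_
    · rw [add_comm, ← orthSum, orthSum_mul, hμβ, hκγ]
    · simp only [← spread_mul, ← spread_add, ← spread_sub, hψc]
    · simp only [← spread_mul, ← spread_add, ← spread_sub, hθb]
    · rw [orthSum_mul, hβ2, hγ2]
      exact h
  rw [← spread_mul, ← spread_mul] at key
  have ha3 : IsPosElem (a * a * a) := by
    obtain ⟨s, hs, rfl⟩ := ha.exists_sqrt
    exact ⟨s * s * s, by simp only [star_mul, hs.star_eq]; noncomm_ring⟩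
  exact ha.cuntzLE_cube.trans <| (mvnEquiv_spread 0 ha3).cuntzLE.trans <|
    key.trans (mvnEquiv_spread 0 hb).symm.cuntzLE

end Stabilization

theorem mainTheorem6 {A : Type*} [NonUnitalCStarAlgebra A]
    (hA : PropertyI (Unitization ℂ (Stabilization A))) :
    WeakCancellation (CuntzSemigroup A) := by
  intro x y z h
  induction x using Quotient.inductionOn with | h a => ?_
  induction y using Quotient.inductionOn with | h b => ?_
  induction z using Quotient.inductionOn with | h c => ?_
  obtain ⟨ε, hε, hle⟩ := CuntzSemigroup.exists_cuntzLE_orthSum_cutDown a.2 b.2 c.2 h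
  exact Stabilization.cuntzLE_of_cuntzLE_orthSum_cutDown hA a.2 b.2 c.2 hε hle
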